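/- All graphs are finite and simple, except that the exponential graph defined below may have loops a priori. For graphs $G,H$, the product $G\times H$ has vertex set $V(G)\times V(H)$, with $(x,y)\sim(x',y')$ if and only if $xx'\in E(G)$ and $yy'\in E(H)$. The graph $G[K_q]$ has vertex set $V(G)\times\{1,\dots,q\}$, with $(x,i)\sim(y,j)$ if and only if $xy\in E(G)$, or $x=y$ and $i\neq j$. The exponential graph $K_c^{G}$ has as vertices all maps $V(G)\to\{1,\dots,c\}$, with $\phi\sim\psi$ if and only if $\phi(x)\ne\psi(y)$ whenever $x,y$ are adjacent in $G$. The fractional chromatic number $\chi_f(G)$ is the least total weight of a nonnegative weighting of the independent sets of $G$ in which, for every vertex $v$, the independent sets containing $v$ have total weight at least $1$. The Poljak–Rödl function is $f(n)=\min\{\chi(G\times H):\chi(G)\ge n,\ \chi(H)\ge n\}$. **Theorem.** (1) Let $d\ge 1$ be an integer and let $G$ be a graph of girth at least $6$ with $\chi_f(G)\ge 8.1d$. Let $p=|V(G)|$, let $q\ge 2^{p-1}p^2$ be an integer, and let $c=4q+2$. Then $\chi(G[K_q])\ge 2dc-2c+2$, the graph $K_{dc}^{G[K_q]}$ has no loops,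 and $\chi\bigl(K_{dc}^{G[K_q]}\bigr)\ge 2dc-2c+2$. Consequently $f(2dc-2c+2)\le dc$. (2) For every integer $d\ge 1$ there is a graph $G$ of girth exactly $6$ with $\chi_f(G)\ge 8.1d$. (3) $f(n)\le\left(\tfrac12+o(1)\right)n$ as $n\to\infty$; that is, $\limsup_{n\to\infty} f(n)/n\le\tfrac12$. -/

import Mathlib

open Filter Topology

/-- The (categorical) product `G × H`: `(x, y)` and `(x', y')` are adjacent if and only if
`x` is adjacent to `x'` in `G` and `y` is adjacent to `y'` in `H`. -/
def graphProduct {V W : Type*} (G : SimpleGraph V) (H : SimpleGraph W) :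
    SimpleGraph (V × W) where
  Adj a b := G.Adj a.1 b.1 ∧ H.Adj a.2 b.2
  symm := ⟨fun _ _ h => ⟨h.1.symm, h.2.symm⟩⟩
  loopless := ⟨fun _ h => h.1.ne rfl⟩

/-- `G[K_q]`: every vertex of `G` is blown up into a `q`-clique. -/
def cliqueBlowup {V : Type*} (G : SimpleGraph V) (q : ℕ) : SimpleGraph (V × Fin q) where
  Adj a b := G.Adj a.1 b.1 ∨ (a.1 = b.1 ∧ a.2 ≠ b.2)
  symm := ⟨fun _ _ h => h.imp (fun h => h.symm) (fun h => ⟨h.1.symm, h.2.symm⟩)⟩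
  loopless := ⟨fun _ h => h.elim (fun h => h.ne rfl) (fun h => h.2 rfl)⟩

/-- The adjacency relation of the exponential graph `K_c^G` on the maps `V(G) → [c]`, loops
included: `f ∼ g` if and only if `f x ≠ g y` for every edge `xy` of `G`. As `G.Adj` is symmetric,
both orientations of each edge are tested. -/
def ExpAdj {V : Type*} (G : SimpleGraph V) (c : ℕ) (f g : V → Fin c) : Prop :=
  ∀ x y : V, G.Adj x y → f x ≠ g y

/-- The exponential graph `K_c^G` as a simple graph, that is, with the loops `ExpAdj G c f f`
removed. A loop at `f` is there exactly when `f` is a proper `c`-colouring of `G`, so nothing is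
removed if `G` is not `c`-colourable. -/
def expGraph {V : Type*} (G : SimpleGraph V) (c : ℕ) : SimpleGraph (V → Fin c) where
  Adj f g := f ≠ g ∧ ExpAdj G c f g
  symm := ⟨fun _ _ h => ⟨h.1.symm, fun x y hxy he => h.2 y x hxy.symm he.symm⟩⟩
  loopless := ⟨fun _ h => h.1 rfl⟩

open Classical in
/-- A fractional colouring of a finite graph: nonnegative weights on the independent sets
(weight `0` on all other sets) such that the independent sets containing any given vertex have
total weight at least `1`. -/
def IsFractionalColoring {V : Type*} [Fintype V] (G : SimpleGraph V) (w : Finset V → ℝ) : Prop :=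
  (∀ I : Finset V, 0 ≤ w I) ∧
  (∀ I : Finset V, w I ≠ 0 → G.IsIndepSet (I : Set V)) ∧
  ∀ v : V, 1 ≤ ∑ I : Finset V with v ∈ I, w I

/-- The fractional chromatic number `χ_f(G)` of a finite graph: the least total weight of a
fractional colouring. -/
noncomputable def fractionalChromaticNumber {V : Type*} [Fintype V] (G : SimpleGraph V) : ℝ :=
  sInf {r : ℝ | ∃ w : Finset V → ℝ, IsFractionalColoring G w ∧ r = ∑ I : Finset V, w I}

/-- The values `χ(G × H)` over all finite graphs `G`, `H` with `χ(G), χ(H) ≥ n`. -/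
def poljakRodlValues (n : ℕ) : Set ℕ :=
  {k : ℕ | ∃ (V W : Type) (_ : Fintype V) (_ : Fintype W) (G : SimpleGraph V) (H : SimpleGraph W),
    (n : ℕ∞) ≤ G.chromaticNumber ∧ (n : ℕ∞) ≤ H.chromaticNumber ∧
    (graphProduct G H).chromaticNumber = (k : ℕ∞)}

/-- The minimum in the definition of the Poljak–Rödl function is over a nonempty set. -/
theorem poljakRodlValues_nonempty (n : ℕ) : (poljakRodlValues n).Nonempty := by
  have hc : (graphProduct (⊤ : SimpleGraph (Fin n)) (⊤ : SimpleGraph (Fin n))).chromaticNumber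
      ≠ ⊤ :=
    SimpleGraph.chromaticNumber_ne_top_iff_exists.2
      ⟨_, SimpleGraph.colorable_of_fintype _⟩
  obtain ⟨k, hk⟩ := ENat.ne_top_iff_exists.1 hc
  exact ⟨k, Fin n, Fin n, inferInstance, inferInstance, ⊤, ⊤, by simp, by simp, hk.symm⟩

/-- The Poljak–Rödl function `f(n) = min {χ(G × H) : χ(G), χ(H) ≥ n}`, over finite graphs. -/
noncomputable def poljakRodl (n : ℕ) : ℕ := sInf (poljakRodlValues n)

/-! Write `H = G[K_q]` and `m = d c`. The evaluation `(x, φ) ↦ φ x` is an `m`-colouring of `H ×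
K_m^H`, so `f` is at most `m` at any bound that `χ(H)` and `χ(K_m^H)` share (`poljakRodl_le`). For
`H` use `χ(H) ≥ q χ_f(G)`; this also exceeds `m`, which excludes loops.

In a proper colouring of `K_m^H` the `m` constant maps form a clique and take `m` colours; call the
other colours free. Every `c`-set `S` of values carries a map into `S` with a free colour. Otherwise
each map into `S` has the colour of a constant map, whose value it must attain (else the two are
adjacent), and Shitov's argument `not_suited`, which needs `G` without 3- and 5-cycles, refutes
this. Maps into disjoint sets are adjacent, so the free colours properly colour the Kneser graph of
`c`-subsets of an `m`-set. For `d ≥ 2`, Lovász's theorem `exists_disjoint_same_colour` gives at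
least `m - 2c + 2` of them, hence `2m - 2c + 2` colours in total. Lovász's theorem follows from the
octahedral Tucker lemma, which is a parity count of alternating flags.

Suitable `G` come from Erdős's deletion method, with `χ_f` bounded below through the sizes of
independent sets. As `d` grows, the ratio `d c / (2 d c - 2 c)` tends to `1/2`, and monotonicity of
`f` fills the gaps between the arguments reached. -/

/-! ### Alternating lists of labels, modulo 2 -/

/-- `1` if the parities of the entries of the list alternate, starting with an odd entry if `b` is
`true` and with an even entry otherwise; `0` if not. -/
def altList : Bool → List ℕ → ZMod 2
  | _, [] => 1
  | b, x :: xs => if decide (x % 2 = 1) = b then altList (!b) xs else 0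

/-- Alternation of the sorted list of a multiset of labels. -/
def altCount (b : Bool) (M : Multiset ℕ) : ZMod 2 := altList b (M.sort (· ≤ ·))

/-- Parity count of the alternating facets of a simplex. If the head fits, the terms for the tail
are `altList (!b) xs + altList b xs` by induction, and deletion of the head cancels the second. If
it does not fit, only deletion of the head survives. -/
theorem altList_sum_eraseIdx (L : List ℕ) : ∀ b : Bool,
    ∑ i ∈ Finset.range L.length, altList b (L.eraseIdx i) = altList b L + altList (!b) L := by
  induction L with
  | nil => intro b; simpa [altList] using (by decide : (0 : ZMod 2) = 1 + 1)
  | cons x xs ih =>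
    intro b
    rw [List.length_cons, Finset.sum_range_succ']
    simp only [List.eraseIdx_cons_succ, List.eraseIdx_cons_zero]
    simp only [altList]
    by_cases h : decide (x % 2 = 1) = b
    · have h' : ¬ decide (x % 2 = 1) = !b := by rw [h]; cases b <;> decide
      simp only [h, if_true, ih]
      have h2 : ∀ a c : ZMod 2, a + c + c = a + 0 := by decide
      have := h2 (altList (!b) xs) (altList (!!b) xs)
      cases b <;> simpa using this
    · have h' : decide (x % 2 = 1) = !b := by
        revert h; cases decide (x % 2 = 1) <;> cases b <;> decide
      have h3 : ¬ ((!b) = b) := by cases b <;> decide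
      simp [h', h3]

theorem altCount_sum_erase (b : Bool) (M : Multiset ℕ) :
    (M.map fun a => altCount b (M.erase a)).sum = altCount b M + altCount (!b) M := by
  set L := M.sort (· ≤ ·) with hL
  have hM : M = (L : Multiset ℕ) := (Multiset.sort_eq M _).symm
  have hs : L.Pairwise (· ≤ ·) := Multiset.pairwise_sort M _
  unfold altCount
  rw [← hL, ← altList_sum_eraseIdx]
  have key : ∀ i (hi : i < L.length), (M.erase L[i]).sort (· ≤ ·) = L.eraseIdx i := by
    intro i hi
    refine List.Perm.eq_of_pairwise' (r := (· ≤ ·)) (Multiset.pairwise_sort _ _)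
      (hs.sublist (List.eraseIdx_sublist _ _)) ?_
    rw [← Multiset.coe_eq_coe, Multiset.sort_eq, hM, Multiset.coe_erase, Multiset.coe_eq_coe]
    exact List.erase_getElem hi
  conv_lhs => rw [hM]
  have hof : ∀ f : ℕ → ZMod 2, L.map f = List.ofFn fun i : Fin L.length => f L[i] := fun f =>
    List.ext_getElem (by simp) (by simp)
  rw [Multiset.map_coe, Multiset.sum_coe, ← hM, hof, List.sum_ofFn, Finset.sum_range]
  exact Finset.sum_congr rfl fun i _ => congrArg (altList b) (key i i.2)

/-- Exchange of the labels `2 j` and `2 j + 1`. -/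
def flipLabel (a : ℕ) : ℕ := if a % 2 = 0 then a + 1 else a - 1

theorem altList_map_flipLabel (L : List ℕ) : ∀ b, altList b (L.map flipLabel) = altList (!b) L := by
  induction L with
  | nil => intro b; rfl
  | cons x xs ih =>
    intro b
    simp only [List.map_cons, altList, ih]
    have : decide (flipLabel x % 2 = 1) = !decide (x % 2 = 1) := by
      unfold flipLabel
      split_ifs with h
      · have h1 : (x + 1) % 2 = 1 := by omega
        simp [h, h1]
      · have h1 : (x - 1) % 2 = 0 := by omega
        have h2 : x % 2 = 1 := by omega
        simp [h1, h2]
    rw [this]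
    cases decide (x % 2 = 1) <;> cases b <;> rfl

/-- Without two labels from one pair, `flipLabel` preserves order, so it acts entrywise on the
sorted list and reverses each parity. -/
theorem altCount_map_flipLabel (b : Bool) (M : Multiset ℕ)
    (h : ∀ x ∈ M, ∀ y ∈ M, x / 2 = y / 2 → x = y) :
    altCount b (M.map flipLabel) = altCount (!b) M := by
  unfold altCount
  rw [← Multiset.map_sort flipLabel M (· ≤ ·) (· ≤ ·), altList_map_flipLabel]
  intro x hx y hy
  have := h x hx y hy
  unfold flipLabel
  split_ifs <;> omega

/-- Equal neighbours would break alternation, so the sorted list increases strictly; halving is then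
injective into `m` values. -/
theorem card_le_of_altCount_ne_zero {b : Bool} {M : Multiset ℕ} {m : ℕ}
    (h : ∀ x ∈ M, ∀ y ∈ M, x / 2 = y / 2 → x = y) (hm : ∀ x ∈ M, x < 2 * m)
    (hb : altCount b M ≠ 0) : M.card ≤ m := by
  have key : ∀ (L : List ℕ) (b : Bool), L.Pairwise (· ≤ ·) → altList b L ≠ 0 →
      L.IsChain (· < ·) := by
    intro L
    induction L with
    | nil => intro b _ _; exact List.IsChain.nil
    | cons x xs ih =>
      intro b hp hb
      simp only [altList] at hb
      split_ifs at hb with hx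
      · have hc := ih _ (List.pairwise_cons.1 hp).2 hb
        cases xs with
        | nil => exact List.IsChain.singleton _
        | cons y ys =>
          refine List.IsChain.cons_cons ?_ hc
          have hle := (List.pairwise_cons.1 hp).1 y (by simp)
          rcases hle.lt_or_eq with hlt | rfl
          · exact hlt
          · simp only [altList, hx] at hb
            cases b <;> simp at hb
      · exact absurd rfl hb
  have hc := (key _ b (Multiset.pairwise_sort M (· ≤ ·)) hb).pairwise
  have hnd : M.Nodup := by
    rw [← Multiset.sort_eq M (· ≤ ·), Multiset.coe_nodup]
    exact hc.imp (fun h => h.ne)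
  have hnd' : (M.map (· / 2)).Nodup := hnd.map_on h
  have hcard : M.card = (M.map (· / 2)).toFinset.card := by
    rw [Multiset.toFinset_card_of_nodup hnd', Multiset.card_map]
  rw [hcard]
  calc _ ≤ (Finset.range m).card := Finset.card_le_card (by
        intro a ha
        simp only [Multiset.mem_toFinset, Multiset.mem_map] at ha
        obtain ⟨x, hx, rfl⟩ := ha
        have := hm x hx
        simp; omega)
    _ = m := Finset.card_range m

/-! ### Flags of the cross-polytope and Tucker's lemma -/

/-- The sign vector that agrees with the signs `s` on the coordinates of rank at most `i`, and
vanishes elsewhere. -/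
def flagVec {n : ℕ} (ρ : Equiv.Perm (Fin n)) (s : Fin n → Bool) (i : ℕ) : Fin n → SignType :=
  fun j => if (ρ j : ℕ) ≤ i then (if s j then 1 else -1) else 0

theorem flagVec_le {n : ℕ} (ρ : Equiv.Perm (Fin n)) (s : Fin n → Bool) {i i' : ℕ} (h : i ≤ i')
    (j : Fin n) (hj : flagVec ρ s i j ≠ 0) : flagVec ρ s i' j = flagVec ρ s i j := by
  unfold flagVec at *
  by_cases h1 : (ρ j : ℕ) ≤ i
  · rw [if_pos h1, if_pos (h1.trans h)]
  · simp [h1] at hj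

theorem flagVec_ne_zero {n : ℕ} (ρ : Equiv.Perm (Fin n)) (s : Fin n → Bool) {i : ℕ} (h : i < n) :
    flagVec ρ s i ≠ 0 := by
  intro h0
  have := congrFun h0 (ρ.symm ⟨i, h⟩)
  simp only [flagVec, Equiv.apply_symm_apply, le_refl, if_true, Pi.zero_apply] at this
  split_ifs at this

/-- The flags of the upper hemisphere of the cross-polytope spanned by the first `t` coordinates. -/
def hemisphereFlags (n t : ℕ) : Finset (Equiv.Perm (Fin n) × (Fin n → Bool)) :=
  Finset.univ.filter fun p =>
    (∀ j : Fin n, t ≤ j → p.1 j = j) ∧ ∀ j : Fin n, t ≤ (j : ℕ) + 1 → p.2 j = true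

theorem mem_hemisphereFlags {n t : ℕ} {p : Equiv.Perm (Fin n) × (Fin n → Bool)} :
    p ∈ hemisphereFlags n t ↔
      (∀ j : Fin n, t ≤ j → p.1 j = j) ∧ ∀ j : Fin n, t ≤ (j : ℕ) + 1 → p.2 j = true := by
  simp [hemisphereFlags]

/-- The labels of the first `t` members of a flag. -/
def flagLabels {n : ℕ} (lam : (Fin n → SignType) → ℕ) (t : ℕ)
    (p : Equiv.Perm (Fin n) × (Fin n → Bool)) : Multiset ℕ :=
  (Multiset.range t).map fun i => lam (flagVec p.1 p.2 i)

theorem val_lt_of_fixes_ge {n t : ℕ} {ρ : Equiv.Perm (Fin n)} (h : ∀ j : Fin n, t ≤ j → ρ j = j)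
    {j : Fin n} (hj : (ρ j : ℕ) < t) : (j : ℕ) < t := by
  by_contra hc
  push Not at hc
  rw [h j hc] at hj
  omega

section Tucker

variable {n : ℕ} (lam : (Fin n → SignType) → ℕ)

theorem flagLabels_noncomplementary
    (hcomp : ∀ x y : Fin n → SignType, x ≠ 0 → (∀ i, x i ≠ 0 → y i = x i) →
      lam x / 2 = lam y / 2 → lam x = lam y) {t : ℕ} (ht : t ≤ n)
    (p : Equiv.Perm (Fin n) × (Fin n → Bool)) :
    ∀ x ∈ flagLabels lam t p, ∀ y ∈ flagLabels lam t p, x / 2 = y / 2 → x = y := by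
  intro x hx y hy hxy
  simp only [flagLabels, Multiset.mem_map, Multiset.mem_range] at hx hy
  obtain ⟨i, hi, rfl⟩ := hx
  obtain ⟨j, hj, rfl⟩ := hy
  rcases le_total i j with hij | hij
  · exact hcomp _ _ (flagVec_ne_zero _ _ (hi.trans_le ht)) (flagVec_le _ _ hij) hxy
  · exact (hcomp _ _ (flagVec_ne_zero _ _ (hj.trans_le ht)) (flagVec_le _ _ hij) hxy.symm).symm

/-- Interchanging the ranks `i` and `i + 1` changes only member `i` of the flag, so flags sharing
this facet cancel in pairs. -/
theorem sum_erase_inner_eq_zero {t i : ℕ} (hi : i < t) (ht : t + 1 ≤ n) :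
    ∑ p ∈ hemisphereFlags n (t + 1),
      altCount true ((flagLabels lam (t + 1) p).erase (lam (flagVec p.1 p.2 i))) = 0 := by
  have herase : ∀ p : Equiv.Perm (Fin n) × (Fin n → Bool),
      (flagLabels lam (t + 1) p).erase (lam (flagVec p.1 p.2 i)) =
        ((Multiset.range (t + 1)).erase i).map fun i => lam (flagVec p.1 p.2 i) := by
    intro p
    rw [flagLabels, Multiset.map_erase_of_mem]
    simp; omega
  simp only [herase]
  set a : Fin n := ⟨i, by omega⟩
  set b : Fin n := ⟨i + 1, by omega⟩
  have hab : a ≠ b := by simp [a, b]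
  refine Finset.sum_involution (fun p _ => (Equiv.swap a b * p.1, p.2)) ?_ ?_ ?_ ?_
  · intro p hp
    have : ((Multiset.range (t + 1)).erase i).map (fun i => lam (flagVec p.1 p.2 i)) =
        ((Multiset.range (t + 1)).erase i).map
          (fun i => lam (flagVec (Equiv.swap a b * p.1) p.2 i)) := by
      refine Multiset.map_congr rfl fun k hk => ?_
      have hki : k ≠ i := ((Multiset.nodup_range _).mem_erase_iff.1 hk).1
      congr 1
      funext j
      have : ((p.1 j : ℕ) ≤ k) ↔ (((Equiv.swap a b * p.1) j : Fin n) : ℕ) ≤ k := by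
        rw [Equiv.Perm.mul_apply]
        by_cases h1 : p.1 j = a
        · rw [h1, Equiv.swap_apply_left]; simp only [a, b]; omega
        · by_cases h2 : p.1 j = b
          · rw [h2, Equiv.swap_apply_right]; simp only [a, b]; omega
          · rw [Equiv.swap_apply_of_ne_of_ne h1 h2]
      simp only [flagVec, this]
    rw [this]
    exact CharTwo.add_self_eq_zero _
  · intro p hp _ h
    have h1 : Equiv.swap a b * p.1 = p.1 := congrArg Prod.fst h
    have h2 : Equiv.swap a b = 1 := by simpa using h1
    exact hab (Equiv.swap_eq_one_iff.1 h2)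
  · intro p hp
    rw [mem_hemisphereFlags] at hp ⊢
    refine ⟨fun j hj => ?_, hp.2⟩
    rw [Equiv.Perm.mul_apply, hp.1 j hj, Equiv.swap_apply_of_ne_of_ne] <;>
    · intro h; rw [h] at hj; simp only [a, b] at hj; omega
  · intro p hp
    simp

theorem flagLabels_congr {t : ℕ} {ρ : Equiv.Perm (Fin n)} {s s' : Fin n → Bool}
    (h : ∀ j, (ρ j : ℕ) < t → s j = s' j) : flagLabels lam t (ρ, s) = flagLabels lam t (ρ, s') := by
  refine Multiset.map_congr rfl fun k hk => ?_
  rw [Multiset.mem_range] at hk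
  congr 1
  funext j
  simp only [flagVec]
  by_cases h1 : (ρ j : ℕ) ≤ k
  · simp only [h j (h1.trans_lt hk)]
  · simp only [h1, if_false]

/-- Facets obtained by deleting the last member. If the coordinate of rank `t` is not `a`, its sign
is free and affects only the deleted member, so such flags cancel in pairs. The others are the flags
of the equator; the antipodal map carries its lower half to the upper half and exchanges the two
kinds of alternation. -/
theorem sum_outer {t : ℕ} (ht0 : 1 ≤ t) (ht : t + 1 ≤ n)
    (hanti : ∀ x : Fin n → SignType, x ≠ 0 → lam (-x) = flipLabel (lam x))
    (hcomp : ∀ x y : Fin n → SignType, x ≠ 0 → (∀ i, x i ≠ 0 → y i = x i) →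
      lam x / 2 = lam y / 2 → lam x = lam y) :
    ∑ p ∈ hemisphereFlags n (t + 1), altCount true (flagLabels lam t p) =
      ∑ p ∈ hemisphereFlags n t,
        (altCount true (flagLabels lam t p) + altCount false (flagLabels lam t p)) := by
  set a : Fin n := ⟨t, by omega⟩ with ha
  set b : Fin n := ⟨t - 1, by omega⟩ with hb
  rw [← Finset.sum_filter_add_sum_filter_not _ (fun p => p.1 a = a)]
  have hzero : ∑ p ∈ hemisphereFlags n (t + 1) with ¬ p.1 a = a,
      altCount true (flagLabels lam t p) = 0 := by
    refine Finset.sum_involution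
      (fun p _ => (p.1, Function.update p.2 (p.1.symm a) (!p.2 (p.1.symm a)))) ?_ ?_ ?_ ?_
    · intro p hp
      have : flagLabels lam t p = flagLabels lam t
          (p.1, Function.update p.2 (p.1.symm a) (!p.2 (p.1.symm a))) := by
        refine flagLabels_congr lam (s := p.2) fun j hj => ?_
        rw [Function.update_of_ne]
        rintro rfl
        simp [ha] at hj
      rw [← this]
      exact CharTwo.add_self_eq_zero _
    · intro p hp _ h
      have h1 := congrFun (congrArg Prod.snd h) (p.1.symm a)
      simp at h1
    · intro p hp
      rw [Finset.mem_filter, mem_hemisphereFlags] at hp ⊢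
      refine ⟨⟨hp.1.1, fun j hj => ?_⟩, hp.2⟩
      dsimp only
      rw [Function.update_of_ne]
      · exact hp.1.2 j hj
      · rintro rfl
        have h1 : t ≤ (p.1.symm a : ℕ) := by omega
        rcases h1.eq_or_lt with h1 | h1
        · have h2 : p.1.symm a = a := Fin.ext h1.symm
          exact hp.2 (by rw [← h2, Equiv.apply_symm_apply]; exact h2.symm)
        · have h2 := hp.1.1 _ h1
          rw [Equiv.apply_symm_apply] at h2
          rw [← h2] at h1
          simp [ha] at h1
    · intro p hp
      simp
  rw [hzero, add_zero, Finset.sum_add_distrib,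
    ← Finset.sum_filter_add_sum_filter_not _ (fun p => p.2 b = true)]
  have hfix : ∀ (p : Equiv.Perm (Fin n) × (Fin n → Bool)),
      (∀ j : Fin n, t ≤ j → p.1 j = j) ↔ (∀ j : Fin n, t + 1 ≤ j → p.1 j = j) ∧ p.1 a = a := by
    intro p
    refine ⟨fun h => ⟨fun j hj => h j (by omega), h a le_rfl⟩, fun h j hj => ?_⟩
    rcases hj.eq_or_lt with hj | hj
    · have : j = a := Fin.ext hj.symm
      rw [this]; exact h.2
    · exact h.1 j hj
  congr 1
  · refine Finset.sum_congr ?_ fun _ _ => rfl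
    ext p
    simp only [Finset.mem_filter, mem_hemisphereFlags, hfix p]
    constructor
    · rintro ⟨⟨⟨h1, h2⟩, h3⟩, h4⟩
      refine ⟨⟨h1, h3⟩, fun j hj => ?_⟩
      by_cases hj' : t ≤ (j : ℕ)
      · exact h2 j (by omega)
      · have : j = b := Fin.ext (by simp only [hb]; omega)
        rw [this]; exact h4
    · rintro ⟨⟨h1, h3⟩, h2⟩
      exact ⟨⟨⟨h1, fun j hj => h2 j (by omega)⟩, h3⟩, h2 b (by simp only [hb]; omega)⟩
  · have hlab : ∀ p ∈ hemisphereFlags n t, altCount false (flagLabels lam t p) =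
        altCount true (flagLabels lam t (p.1, fun j => if (j : ℕ) < t then !p.2 j else p.2 j)) := by
      intro p hp
      rw [mem_hemisphereFlags] at hp
      have : flagLabels lam t (p.1, fun j => if (j : ℕ) < t then !p.2 j else p.2 j) =
          (flagLabels lam t p).map flipLabel := by
        rw [flagLabels, flagLabels, Multiset.map_map]
        refine Multiset.map_congr rfl fun k hk => ?_
        rw [Multiset.mem_range] at hk
        rw [Function.comp, ← hanti _ (flagVec_ne_zero _ _ (by omega))]
        congr 1
        funext j
        simp only [flagVec, Pi.neg_apply]
        by_cases h1 : (p.1 j : ℕ) ≤ k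
        · have h2 : (j : ℕ) < t := val_lt_of_fixes_ge hp.1 (h1.trans_lt hk)
          simp only [h1, h2, if_true]
          cases p.2 j <;> rfl
        · simp [h1]
      rw [this, altCount_map_flipLabel _ _ (flagLabels_noncomplementary lam hcomp (by omega) p)]
      rfl
    rw [Finset.sum_congr rfl hlab]
    have hinv : ∀ p : Equiv.Perm (Fin n) × (Fin n → Bool),
        (p.1, fun j : Fin n => if (j : ℕ) < t then
          !(if (j : ℕ) < t then !p.2 j else p.2 j) else
            (if (j : ℕ) < t then !p.2 j else p.2 j)) = p := by
      intro p
      refine Prod.ext rfl (funext fun j => ?_)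
      dsimp only
      split_ifs <;> simp
    refine Finset.sum_nbij' (fun p => (p.1, fun j => if (j : ℕ) < t then !p.2 j else p.2 j))
      (fun p => (p.1, fun j => if (j : ℕ) < t then !p.2 j else p.2 j)) ?_ ?_ ?_ ?_ ?_
    · intro p hp
      simp only [Finset.mem_filter, mem_hemisphereFlags, hfix p, Bool.not_eq_true] at hp ⊢
      obtain ⟨⟨⟨h1, h2⟩, h3⟩, h4⟩ := hp
      refine ⟨⟨h1, h3⟩, fun j hj => ?_⟩
      by_cases hj' : t ≤ (j : ℕ)
      · rw [if_neg (by omega)]; exact h2 j (by omega)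
      · have : j = b := Fin.ext (by simp only [hb]; omega)
        rw [if_pos (by omega), this, h4]; rfl
    · intro p hp
      simp only [Finset.mem_filter, mem_hemisphereFlags, Bool.not_eq_true] at hp ⊢
      obtain ⟨h1, h2⟩ := hp
      refine ⟨⟨⟨((hfix p).1 h1).1, fun j hj => ?_⟩, ((hfix p).1 h1).2⟩, ?_⟩
      · rw [if_neg (by omega)]; exact h2 j (by omega)
      · rw [if_pos (by simp only [hb]; omega), h2 b (by simp only [hb]; omega)]; rfl
    · intro p _; exact hinv p
    · intro p _; exact hinv p
    · intro p _; exact congrArg (fun q => altCount true (flagLabels lam t q)) (hinv p).symm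

/-- Ky Fan's parity count by induction on dimension. Alternating flags of the hemisphere have the
parity of its alternating facets; interior facets cancel and the equator gives the count one
dimension lower. -/
theorem sum_hemisphereFlags_eq_one
    (hanti : ∀ x : Fin n → SignType, x ≠ 0 → lam (-x) = flipLabel (lam x))
    (hcomp : ∀ x y : Fin n → SignType, x ≠ 0 → (∀ i, x i ≠ 0 → y i = x i) →
      lam x / 2 = lam y / 2 → lam x = lam y) (t : ℕ) (ht0 : 1 ≤ t) (ht : t ≤ n) :
    ∑ p ∈ hemisphereFlags n t,
      (altCount true (flagLabels lam t p) + altCount false (flagLabels lam t p)) = 1 := by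
  induction t, ht0 using Nat.le_induction with
  | base =>
    have hP : hemisphereFlags n 1 = {(1, fun _ => true)} := by
      ext p
      rw [mem_hemisphereFlags, Finset.mem_singleton]
      constructor
      · rintro ⟨h1, h2⟩
        refine Prod.ext (Equiv.ext fun j => ?_) (funext fun j => h2 j (by omega))
        by_cases hj : 1 ≤ (j : ℕ)
        · exact h1 j hj
        · by_contra hne
          have h3 : 1 ≤ (p.1 j : ℕ) := by
            by_contra h4
            exact hne (Fin.ext (by simp only [Equiv.Perm.one_apply]; omega))
          have := p.1.injective (h1 _ h3)
          exact hne this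
      · rintro rfl; simp
    rw [hP, Finset.sum_singleton]
    have h1 : flagLabels lam 1 (1, fun _ => true) = {lam (flagVec 1 (fun _ => true) 0)} := by
      simp [flagLabels, Multiset.range_succ]
    rw [h1]
    simp only [altCount, Multiset.sort_singleton, altList]
    cases decide (lam (flagVec 1 (fun _ => true) 0) % 2 = 1) <;> simp
  | succ t ht0 ih =>
    rw [← ih (by omega), ← sum_outer lam ht0 ht hanti hcomp]
    have h1 : ∀ p, altCount true (flagLabels lam (t + 1) p) +
        altCount false (flagLabels lam (t + 1) p) = ∑ i ∈ Finset.range (t + 1),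
          altCount true ((flagLabels lam (t + 1) p).erase (lam (flagVec p.1 p.2 i))) := by
      intro p
      have := altCount_sum_erase true (flagLabels lam (t + 1) p)
      rw [Bool.not_true] at this
      rw [← this]
      conv_lhs => rw [flagLabels, Multiset.map_map]
      rfl
    rw [Finset.sum_congr rfl fun p _ => h1 p, Finset.sum_comm, Finset.sum_range_succ,
      Finset.sum_eq_zero fun i hi => sum_erase_inner_eq_zero lam (Finset.mem_range.1 hi) ht,
      zero_add]
    refine Finset.sum_congr rfl fun p _ => ?_
    congr 1
    rw [flagLabels, Multiset.range_succ, Multiset.map_cons, Multiset.erase_cons_head, flagLabels]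

/-- The octahedral Tucker lemma. -/
theorem octahedral_tucker {m : ℕ} (hlt : ∀ x : Fin n → SignType, x ≠ 0 → lam x < 2 * m)
    (hanti : ∀ x : Fin n → SignType, x ≠ 0 → lam (-x) = flipLabel (lam x))
    (hcomp : ∀ x y : Fin n → SignType, x ≠ 0 → (∀ i, x i ≠ 0 → y i = x i) →
      lam x / 2 = lam y / 2 → lam x = lam y) : n ≤ m := by
  rcases Nat.eq_zero_or_pos n with rfl | hn
  · exact Nat.zero_le _
  have h := sum_hemisphereFlags_eq_one lam hanti hcomp n hn le_rfl
  obtain ⟨p, -, hp⟩ := Finset.exists_ne_zero_of_sum_ne_zero (by rw [h]; exact one_ne_zero)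
  have hb : ∃ b, altCount b (flagLabels lam n p) ≠ 0 := by
    by_contra hc
    push Not at hc
    exact hp (by rw [hc, hc, add_zero])
  obtain ⟨b, hb⟩ := hb
  have := card_le_of_altCount_ne_zero (m := m)
    (flagLabels_noncomplementary lam hcomp le_rfl p) (fun x hx => ?_) hb
  · simpa [flagLabels] using this
  · simp only [flagLabels, Multiset.mem_map, Multiset.mem_range] at hx
    obtain ⟨i, hi, rfl⟩ := hx
    exact hlt _ (flagVec_ne_zero _ _ hi)

end Tucker

/-! ### Lovász's theorem on Kneser graphs -/

section Kneser

variable {n : ℕ} (k : ℕ) (κ : Finset (Fin n) → ℕ)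

/-- The coordinates at which a sign vector takes the value `e`. -/
def signSet (x : Fin n → SignType) (e : SignType) : Finset (Fin n) :=
  Finset.univ.filter fun i => x i = e

theorem mem_signSet {x : Fin n → SignType} {e : SignType} {i : Fin n} :
    i ∈ signSet x e ↔ x i = e := by simp [signSet]

theorem signSet_neg (x : Fin n → SignType) (e : SignType) : signSet (-x) e = signSet x (-e) := by
  ext i; simp only [mem_signSet, Pi.neg_apply]; exact neg_eq_iff_eq_neg

theorem disjoint_signSet (x : Fin n → SignType) {e e' : SignType} (h : e ≠ e') :
    Disjoint (signSet x e) (signSet x e') := by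
  rw [Finset.disjoint_left]
  intro i hi hi'
  rw [mem_signSet] at hi hi'
  exact h (hi.symm.trans hi')

/-- The number of nonzero coordinates. -/
def signSupp (x : Fin n → SignType) : ℕ := (signSet x 1).card + (signSet x (-1)).card

theorem signSupp_neg (x : Fin n → SignType) : signSupp (-x) = signSupp x := by
  rw [signSupp, signSupp, signSet_neg, signSet_neg, neg_neg, add_comm]

/-- The first nonzero coordinate has sign `e`. -/
def FirstSign (x : Fin n → SignType) (e : SignType) : Prop := ∃ i, x i = e ∧ ∀ j < i, x j = 0

theorem firstSign_neg (x : Fin n → SignType) (e : SignType) :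
    FirstSign (-x) e ↔ FirstSign x (-e) := by
  simp only [FirstSign, Pi.neg_apply, neg_eq_iff_eq_neg, neg_zero]

theorem firstSign_neg_one_iff {x : Fin n → SignType} (hx : x ≠ 0) :
    FirstSign x (-1) ↔ ¬ FirstSign x 1 := by
  constructor
  · rintro ⟨i, hi, hi'⟩ ⟨j, hj, hj'⟩
    rcases lt_trichotomy i j with h | rfl | h
    · rw [hj' i h] at hi; exact absurd hi (by decide)
    · rw [hi] at hj; exact absurd hj (by decide)
    · rw [hi' j h] at hj; exact absurd hj (by decide)
  · intro h
    have hne : (Finset.univ.filter fun i => x i ≠ 0).Nonempty := by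
      obtain ⟨i, hi⟩ := Function.ne_iff.1 hx
      exact ⟨i, by simpa using hi⟩
    set i := Finset.min' _ hne with hi
    have h1 : x i ≠ 0 := (Finset.mem_filter.1 (Finset.min'_mem _ hne)).2
    have h2 : ∀ j < i, x j = 0 := by
      intro j hj
      by_contra hc
      exact absurd (Finset.min'_le _ j (by simpa using hc)) (not_le.2 hj)
    refine ⟨i, ?_, h2⟩
    rcases SignType.trichotomy (x i) with h3 | h3 | h3
    · exact h3
    · exact absurd h3 h1
    · exact absurd ⟨i, h3, h2⟩ h

/-- `c` is the colour of a `k`-subset of the coordinates of sign `e`. -/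
def HasColour (x : Fin n → SignType) (e : SignType) (c : ℕ) : Prop :=
  ∃ F ⊆ signSet x e, F.card = k ∧ κ F = c

theorem hasColour_neg (x : Fin n → SignType) (e : SignType) (c : ℕ) :
    HasColour k κ (-x) e c ↔ HasColour k κ x (-e) c := by
  simp only [HasColour, signSet_neg]

/-- The least colour of a `k`-set of coordinates of constant sign. -/
noncomputable def leastColour (x : Fin n → SignType) : ℕ :=
  sInf {c | HasColour k κ x 1 c ∨ HasColour k κ x (-1) c}

theorem leastColour_neg (x : Fin n → SignType) : leastColour k κ (-x) = leastColour k κ x := by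
  simp only [leastColour, hasColour_neg, neg_neg, or_comm]

/-- Pigeonhole: more than `2k - 2` nonzero coordinates include `k` of one sign, so the infimum is
not the default value of the empty set. -/
theorem leastColour_mem {x : Fin n → SignType} (hx : 2 * k - 2 < signSupp x) :
    HasColour k κ x 1 (leastColour k κ x) ∨ HasColour k κ x (-1) (leastColour k κ x) := by
  refine Nat.sInf_mem (s := {c | HasColour k κ x 1 c ∨ HasColour k κ x (-1) c}) ?_
  have : k ≤ (signSet x 1).card ∨ k ≤ (signSet x (-1)).card := by
    unfold signSupp at hx; omega
  rcases this with h | h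
  · obtain ⟨F, hF, hc⟩ := Finset.exists_subset_card_eq h
    exact ⟨κ F, Or.inl ⟨F, hF, hc, rfl⟩⟩
  · obtain ⟨F, hF, hc⟩ := Finset.exists_subset_card_eq h
    exact ⟨κ F, Or.inr ⟨F, hF, hc, rfl⟩⟩

open Classical in
/-- Matoušek's labelling of the sign vectors that belongs to a colouring of the `k`-sets. -/
noncomputable def kneserLabel (x : Fin n → SignType) : ℕ :=
  if signSupp x ≤ 2 * k - 2 then 2 * (signSupp x - 1) + (if FirstSign x 1 then 1 else 0)
  else 2 * (2 * k - 2 + leastColour k κ x) +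
    (if HasColour k κ x 1 (leastColour k κ x) then 1 else 0)

open Classical in
theorem flipLabel_two_mul_add (a : ℕ) {P Q : Prop} (h : Q ↔ ¬ P) :
    2 * a + (if Q then 1 else 0) = flipLabel (2 * a + if P then 1 else 0) := by
  unfold flipLabel
  by_cases hP : P
  · have hQ : ¬ Q := by tauto
    simp only [hP, hQ, if_true, if_false]; rw [if_neg (by omega)]; omega
  · have hQ : Q := by tauto
    simp only [hP, hQ, if_true, if_false]; rw [if_pos (by omega)]

/-- Lovász's theorem on the chromatic number of Kneser graphs. -/
theorem exists_disjoint_same_colour {t : ℕ} (hk : 1 ≤ k) (hn : t + 2 * k ≤ n + 1)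
    (hκ : ∀ F, F.card = k → κ F < t) :
    ∃ F F', F.card = k ∧ F'.card = k ∧ Disjoint F F' ∧ κ F = κ F' := by
  classical
  by_contra hno
  have hno' : ∀ F F', F.card = k → F'.card = k → Disjoint F F' → κ F ≠ κ F' :=
    fun F F' h h' hd he => hno ⟨F, F', h, h', hd, he⟩
  have hcol : ∀ {x y : Fin n → SignType} {c : ℕ}, Disjoint (signSet x 1) (signSet y (-1)) →
      HasColour k κ x 1 c → HasColour k κ y (-1) c → False := by
    rintro x y c hd ⟨F, hF, hFk, rfl⟩ ⟨F', hF', hFk', he⟩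
    exact hno' F F' hFk hFk' (Finset.disjoint_of_subset_left hF
      (Finset.disjoint_of_subset_right hF' hd)) he.symm
  have hone : (1 : SignType) ≠ -1 := by decide
  have hpos : ∀ x : Fin n → SignType, x ≠ 0 → 1 ≤ signSupp x := by
    intro x hx
    obtain ⟨i, hi⟩ := Function.ne_iff.1 hx
    rcases SignType.trichotomy (x i) with h3 | h3 | h3
    · exact le_add_left (Finset.card_pos.2 ⟨i, mem_signSet.2 h3⟩)
    · exact absurd h3 hi
    · exact le_add_right (Finset.card_pos.2 ⟨i, mem_signSet.2 h3⟩)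
  -- There are `2k - 2` label pairs for the possible small support sizes and `t` for the colours; `n
  -- ≤ 2k - 2 + t` contradicts `hn`.
  have := octahedral_tucker (n := n) (kneserLabel k κ) (m := 2 * k - 2 + t) ?_ ?_ ?_
  · omega
  · intro x hx
    unfold kneserLabel
    have h1 := hpos x hx
    split_ifs with h h2 h2
    · omega
    · omega
    all_goals
      have h3 : leastColour k κ x < t := by
        rcases leastColour_mem k κ (not_le.1 h) with ⟨F, -, hF, h4⟩ | ⟨F, -, hF, h4⟩ <;>
          exact h4 ▸ hκ F hF
      omega
  · intro x hx
    unfold kneserLabel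
    rw [signSupp_neg, leastColour_neg]
    by_cases h : signSupp x ≤ 2 * k - 2
    · rw [if_pos h, if_pos h]
      refine flipLabel_two_mul_add _ ?_
      rw [firstSign_neg, firstSign_neg_one_iff hx]
    · rw [if_neg h, if_neg h]
      refine flipLabel_two_mul_add _ ?_
      rw [hasColour_neg]
      have h2 := leastColour_mem k κ (not_le.1 h)
      exact ⟨fun h3 h4 => hcol (disjoint_signSet x hone) h4 h3, fun h3 => h2.resolve_left h3⟩
  · intro x y hx hxy hlab
    have hsub : ∀ e : SignType, e ≠ 0 → signSet x e ⊆ signSet y e := by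
      intro e he i hi
      rw [mem_signSet] at hi ⊢
      rw [hxy i (by rw [hi]; exact he), hi]
    have hp := hsub 1 (by decide)
    have hm := hsub (-1) (by decide)
    have hle : signSupp x ≤ signSupp y :=
      add_le_add (Finset.card_le_card hp) (Finset.card_le_card hm)
    have hx1 := hpos x hx
    unfold kneserLabel at hlab ⊢
    by_cases hy : signSupp y ≤ 2 * k - 2
    · rw [if_pos hy, if_pos (hle.trans hy)] at hlab ⊢
      -- Nested sign vectors with equally large supports coincide.
      have hsz : signSupp x = signSupp y := by split_ifs at hlab <;> omega
      have h1 : signSet x 1 = signSet y 1 := Finset.eq_of_subset_of_card_le hp (by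
        have := Finset.card_le_card hm; unfold signSupp at hsz; omega)
      have h2 : signSet x (-1) = signSet y (-1) := Finset.eq_of_subset_of_card_le hm (by
        have := Finset.card_le_card hp; unfold signSupp at hsz; omega)
      have hxy' : x = y := by
        funext i
        by_cases h0 : x i = 0
        · rcases SignType.trichotomy (y i) with h3 | h3 | h3
          · rw [h3, ← mem_signSet, h2, mem_signSet]; exact h3
          · rw [h0, h3]
          · rw [h3, ← mem_signSet, h1, mem_signSet]; exact h3
        · exact (hxy i h0).symm
      rw [hxy']
    · rw [if_neg hy] at hlab ⊢
      by_cases hxs : signSupp x ≤ 2 * k - 2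
      · rw [if_pos hxs] at hlab ⊢
        split_ifs at hlab <;> omega
      · rw [if_neg hxs] at hlab ⊢
        have hc : leastColour k κ x = leastColour k κ y := by split_ifs at hlab <;> omega
        have h2x := leastColour_mem k κ (not_le.1 hxs)
        have h2y := leastColour_mem k κ (not_le.1 hy)
        rw [hc] at h2x ⊢
        congr 1
        -- If `y` has the colour on its positive side, `x` cannot have it on the negative side: the
        -- two `k`-sets would be disjoint.
        have hiff : HasColour k κ x 1 (leastColour k κ y) ↔
            HasColour k κ y 1 (leastColour k κ y) := by
          constructor
          · rintro ⟨F, hF, h⟩; exact ⟨F, hF.trans hp, h⟩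
          · intro h
            refine h2x.resolve_right ?_
            intro h'
            exact hcol (Finset.disjoint_of_subset_right hm (disjoint_signSet y hone)) h h'
        simp only [hiff]

end Kneser

/-! ### Short odd closed walks -/

section OddGirth

variable {V : Type*} {G : SimpleGraph V}

theorem not_triangle_of_six_le_egirth (hg : 6 ≤ G.egirth) {a b c : V} (h1 : G.Adj a b)
    (h2 : G.Adj b c) (h3 : G.Adj c a) : False := by
  have hcyc : (SimpleGraph.Walk.cons h1 (.cons h2 (.cons h3 .nil))).IsCycle := by
    rw [SimpleGraph.Walk.cons_isCycle_iff]
    have := h1.ne'; have := h2.ne; have := h3.ne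
    constructor
    · simp_all [SimpleGraph.Walk.cons_isPath_iff]
    · simp_all; tauto
  have := hg.trans (SimpleGraph.egirth_le_length hcyc)
  simp only [SimpleGraph.Walk.length_cons, SimpleGraph.Walk.length_nil] at this
  exact absurd this (by decide)

/-- If two vertices of the walk coincide, a triangle splits off; otherwise the walk is a 5-cycle. -/
theorem not_closed_five_walk_of_six_le_egirth (hg : 6 ≤ G.egirth) {a b c d e : V} (h1 : G.Adj a b)
    (h2 : G.Adj b c) (h3 : G.Adj c d) (h4 : G.Adj d e) (h5 : G.Adj e a) : False := by
  have ht := fun {a b c : V} => not_triangle_of_six_le_egirth (a := a) (b := b) (c := c) hg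
  have hac : a ≠ c := by rintro rfl; exact ht h3 h4 h5
  have had : a ≠ d := by rintro rfl; exact ht h1 h2 h3
  have hbd : b ≠ d := by rintro rfl; exact ht h1 h4 h5
  have hbe : b ≠ e := by rintro rfl; exact ht h2 h3 h4
  have hce : c ≠ e := by rintro rfl; exact ht h1 h2 h5
  have hcyc : (SimpleGraph.Walk.cons h1
      (.cons h2 (.cons h3 (.cons h4 (.cons h5 .nil))))).IsCycle := by
    rw [SimpleGraph.Walk.cons_isCycle_iff]
    have := h1.ne; have := h2.ne; have := h3.ne; have := h4.ne; have := h5.ne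
    have := h5.ne'; have := h1.ne'
    have := hac.symm; have := had.symm; have := hbd.symm
    constructor
    · simp_all [SimpleGraph.Walk.cons_isPath_iff]
    · simp_all
  have := hg.trans (SimpleGraph.egirth_le_length hcyc)
  simp only [SimpleGraph.Walk.length_cons, SimpleGraph.Walk.length_nil] at this
  exact absurd this (by decide)

end OddGirth

/-! ### Shitov's argument -/

section Suited

/-- Among the maps into `S`, those with two prescribed values make up a fraction of `1 / |S| ^ 2`. -/
theorem card_sq_mul_card_le {V α : Type*} [Fintype V] [DecidableEq V] [DecidableEq α]
    (S : Finset α) {v x : V} (hvx : x ≠ v) {s t : α} :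
    S.card ^ 2 * ((Fintype.piFinset fun _ : V => S).filter fun f => f v = s ∧ f x = t).card ≤
      S.card ^ Fintype.card V := by
  have hsub : ((Fintype.piFinset fun _ : V => S).filter fun f => f v = s ∧ f x = t) ⊆
      Fintype.piFinset fun u : V => if u = v then {s} else if u = x then {t} else S := by
    intro f hf
    rw [Finset.mem_filter, Fintype.mem_piFinset] at hf
    rw [Fintype.mem_piFinset]
    intro u
    split_ifs with h1 h2
    · rw [h1, hf.2.1]; exact Finset.mem_singleton_self s
    · rw [h2, hf.2.2]; exact Finset.mem_singleton_self t
    · exact hf.1 u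
  have hx : x ∈ (Finset.univ.erase v : Finset V) := Finset.mem_erase.2 ⟨hvx, Finset.mem_univ x⟩
  have hcard : ((Finset.univ.erase v).erase x : Finset V).card + 2 = Fintype.card V := by
    have h1 := Finset.card_erase_add_one hx
    have h2 := Finset.card_erase_add_one (Finset.mem_univ v)
    rw [Finset.card_univ] at h2
    omega
  calc _ ≤ S.card ^ 2 * (Fintype.piFinset fun u : V =>
          if u = v then {s} else if u = x then {t} else S).card :=
        Nat.mul_le_mul_left _ (Finset.card_le_card hsub)
    _ = S.card ^ 2 * S.card ^ ((Finset.univ.erase v).erase x : Finset V).card := by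
        rw [Fintype.card_piFinset, ← Finset.mul_prod_erase _ _ (Finset.mem_univ v),
          ← Finset.mul_prod_erase _ _ hx, if_pos rfl, if_neg hvx, if_pos rfl,
          Finset.card_singleton, Finset.card_singleton, one_mul, one_mul]
        congr 1
        refine Finset.prod_eq_pow_card fun u hu => ?_
        rw [Finset.mem_erase, Finset.mem_erase] at hu
        rw [if_neg hu.2.1, if_neg hu.1]
    _ = S.card ^ Fintype.card V := by rw [← pow_add, add_comm, hcard]
    _ ≤ _ := le_rfl

/-- If every map `f` into `S` selects one of its values, then some vertex `v` and colour `s` are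
such that `s` is selected at `v` by maps that avoid `s` and any given `τ` elsewhere. -/
theorem exists_robust {V α : Type*} [Fintype V] (S : Finset α) (hS : S.Nonempty)
    (hcard : 2 * Fintype.card V ^ 2 < S.card) (β : (V → α) → α)
    (hβ : ∀ f : V → α, (∀ v, f v ∈ S) → ∃ v, f v = β f) :
    ∃ v : V, ∃ s ∈ S, ∀ τ, ∃ f : V → α, (∀ u, f u ∈ S) ∧ f v = s ∧ β f = s ∧
      ∀ x, x ≠ v → f x ≠ τ ∧ f x ≠ s := by
  classical
  by_contra hno
  push Not at hno
  choose! τ hτ using hno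
  set p := Fintype.card V with hp
  set c := S.card with hc
  -- `E v s x b` are the maps with value `s` at `v` that spoil robustness at `x`, by the value `τ v
  -- s` or by `s` again.
  let E : V → α → V → Bool → Finset (V → α) := fun v s x b =>
    if x = v then ∅ else (Fintype.piFinset fun _ : V => S).filter
      fun f => f v = s ∧ f x = if b then τ v s else s
  have hE : ∀ v s x b, c ^ 2 * (E v s x b).card ≤ c ^ p := by
    intro v s x b
    simp only [E]
    split_ifs with h
    · simp
    · exact card_sq_mul_card_le S h
    · exact card_sq_mul_card_le S h
  have hcover : (Fintype.piFinset fun _ : V => S) ⊆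
      (Finset.univ ×ˢ (S ×ˢ (Finset.univ ×ˢ Finset.univ)) : Finset (V × α × V × Bool)).biUnion
        fun t => E t.1 t.2.1 t.2.2.1 t.2.2.2 := by
    intro f hf
    have hf' := Fintype.mem_piFinset.1 hf
    obtain ⟨v, hv⟩ := hβ f hf'
    obtain ⟨x, hxv, hx⟩ := hτ v (f v) (hf' v) f hf' rfl hv.symm
    rw [Finset.mem_biUnion]
    by_cases h : f x = τ v (f v)
    · refine ⟨(v, f v, x, true), by simp [hf' v], ?_⟩
      simp only [E, if_neg hxv, if_true, Finset.mem_filter]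
      exact ⟨hf, trivial, h⟩
    · refine ⟨(v, f v, x, false), by simp [hf' v], ?_⟩
      simp only [E, if_neg hxv, Finset.mem_filter]
      exact ⟨hf, trivial, hx h⟩
  -- There are `2 p² c` such events, each with at most a fraction `1/c²` of all maps; covering
  -- everything would force `c ≤ 2 p²`.
  have h1 : c ^ 2 * c ^ p ≤ (p * (c * (p * 2))) * c ^ p := by
    calc c ^ 2 * c ^ p = c ^ 2 * (Fintype.piFinset fun _ : V => S).card := by
          rw [Fintype.card_piFinset, Finset.prod_const, Finset.card_univ]
      _ ≤ c ^ 2 * ∑ t ∈ (Finset.univ ×ˢ (S ×ˢ (Finset.univ ×ˢ Finset.univ)) :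
            Finset (V × α × V × Bool)), (E t.1 t.2.1 t.2.2.1 t.2.2.2).card :=
          Nat.mul_le_mul_left _ ((Finset.card_le_card hcover).trans Finset.card_biUnion_le)
      _ ≤ ∑ t ∈ (Finset.univ ×ˢ (S ×ˢ (Finset.univ ×ˢ Finset.univ)) :
            Finset (V × α × V × Bool)), c ^ p := by
          rw [Finset.mul_sum]
          exact Finset.sum_le_sum fun t _ => hE _ _ _ _
      _ = (p * (c * (p * 2))) * c ^ p := by
          simp [Finset.card_product, hp, hc]
  have hc0 : 0 < c := Finset.card_pos.2 hS
  have h2 : c ^ 2 ≤ p * (c * (p * 2)) := Nat.le_of_mul_le_mul_right h1 (pow_pos hc0 p)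
  have h3 : c * c ≤ c * (2 * p ^ 2) := by nlinarith
  have h4 := Nat.le_of_mul_le_mul_left h3 hc0
  omega

/-- Shitov's argument: on the maps from `G[K_q]` into a set `S` of `4 q + 2` colours, there is no
proper colouring that assigns to each map one of its values. -/
theorem not_suited {V α : Type*} [Fintype V] {G : SimpleGraph V} (hg : 6 ≤ G.egirth) {q : ℕ}
    (hq : Fintype.card V ^ 2 ≤ q) {S : Finset α} (hS : S.card = 4 * q + 2)
    (β : (V × Fin q → α) → α)
    (hβ : ∀ φ : V × Fin q → α, (∀ x, φ x ∈ S) → ∃ x, φ x = β φ)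
    (hprop : ∀ φ ψ : V × Fin q → α, (∀ x, φ x ∈ S) → (∀ x, ψ x ∈ S) →
      (∀ x y, (cliqueBlowup G q).Adj x y → φ x ≠ ψ y) → β φ ≠ β ψ) : False := by
  classical
  have hSne : S.Nonempty := Finset.card_pos.1 (by omega)
  -- Maps on `V` are read as maps on `V × Fin q` constant on each clique.
  obtain ⟨v, s, hs, hrob⟩ := exists_robust (V := V) S hSne (by omega)
    (fun f => β fun x => f x.1) (fun f hf => by
      obtain ⟨x, hx⟩ := hβ (fun x => f x.1) fun x => hf x.1
      exact ⟨x.1, hx⟩)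
  obtain ⟨C, hC, hCcard⟩ : ∃ C ⊆ S.erase s, C.card = q + q := by
    refine Finset.exists_subset_card_eq ?_
    rw [Finset.card_erase_of_mem hs]; omega
  have hCS : C ⊆ S := hC.trans (Finset.erase_subset _ _)
  have hsC : s ∉ C := fun h => (Finset.mem_erase.1 (hC h)).1 rfl
  let e : Fin (q + q) ≃ C := (C.equivFinOfCardEq hCcard).symm
  have he : ∀ i j, (e i : α) = e j → i = j := fun i j h => e.injective (Subtype.ext h)
  have heC : ∀ i, (e i : α) ∈ C := fun i => (e i).2
  -- `A` holds the ends of walks of length 0 or 2 from `v`, and `B` the neighbours of `v`. Both are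
  -- independent, so `q` colours suffice on each blow-up.
  let A : V → Prop := fun u => u = v ∨ ∃ w, G.Adj v w ∧ G.Adj w u
  let B : V → Prop := fun u => G.Adj v u
  have ht := fun {a b c : V} => not_triangle_of_six_le_egirth (a := a) (b := b) (c := c) hg
  have hAA : ∀ u u', A u → A u' → ¬ G.Adj u u' := by
    rintro u u' (rfl | ⟨w, h1, h2⟩) (rfl | ⟨w', h1', h2'⟩) h
    · exact G.irrefl h
    · exact ht h1' h2' h.symm
    · exact ht h1 h2 h
    · exact not_closed_five_walk_of_six_le_egirth hg h1 h2 h h2'.symm h1'.symm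
  have hBB : ∀ u u', B u → B u' → ¬ G.Adj u u' := fun u u' h h' hu => ht h hu h'.symm
  -- The colours of `C` are used near `v` and `τ` elsewhere; for distinct `τ` outside `C` these maps
  -- are pairwise adjacent.
  let Φ : α → V × Fin q → α := fun τ x =>
    if A x.1 then e (Fin.castAdd q x.2) else if B x.1 then e (Fin.natAdd q x.2) else τ
  have hΦ : ∀ τ x, Φ τ x ∈ C ∨ Φ τ x = τ := by
    intro τ x
    simp only [Φ]
    split_ifs
    · exact Or.inl (heC _)
    · exact Or.inl (heC _)
    · exact Or.inr rfl
  have hΦC : ∀ τ x, A x.1 ∨ B x.1 → Φ τ x ∈ C := by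
    intro τ x h
    simp only [Φ]
    split_ifs with h1 h2
    · exact heC _
    · exact heC _
    · exact absurd h (not_or.2 ⟨h1, h2⟩)
  have hΦS : ∀ τ ∈ S, ∀ x, Φ τ x ∈ S := fun τ hτ x =>
    (hΦ τ x).elim (fun h => hCS h) (fun h => h.symm ▸ hτ)
  have hcross : ∀ i j, (e (Fin.castAdd q i) : α) ≠ e (Fin.natAdd q j) := by
    intro i j h
    have := congrArg Fin.val (he _ _ h)
    simp at this
    omega
  have hclique : ∀ τ σ, τ ∉ C → σ ∉ C → τ ≠ σ → ∀ x y, (cliqueBlowup G q).Adj x y →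
      Φ τ x ≠ Φ σ y := by
    rintro τ σ hτ hσ hne ⟨u, i⟩ ⟨u', j⟩ hadj
    have hneC : ∀ {a b : α}, a ∈ C → b ∉ C → a ≠ b := fun ha hb h => hb (h ▸ ha)
    by_cases hA : A u <;> by_cases hA' : A u'
    · simp only [Φ, if_pos hA, if_pos hA']
      intro h
      have hij : i = j := by simpa using he _ _ h
      exact hadj.elim (hAA u u' hA hA') fun h => h.2 hij
    · by_cases hB' : B u'
      · simp only [Φ, if_pos hA, if_neg hA', if_pos hB']; exact hcross i j
      · simp only [Φ, if_pos hA, if_neg hA', if_neg hB']; exact hneC (heC _) hσ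
    · by_cases hB : B u
      · simp only [Φ, if_neg hA, if_pos hA', if_pos hB]; exact (hcross j i).symm
      · simp only [Φ, if_neg hA, if_pos hA', if_neg hB]; exact (hneC (heC _) hτ).symm
    · by_cases hB : B u <;> by_cases hB' : B u'
      · simp only [Φ, if_neg hA, if_neg hA', if_pos hB, if_pos hB']
        intro h
        have hij : i = j := by simpa using he _ _ h
        exact hadj.elim (hBB u u' hB hB') fun h => h.2 hij
      · simp only [Φ, if_neg hA, if_neg hA', if_pos hB, if_neg hB']; exact hneC (heC _) hσ
      · simp only [Φ, if_neg hA, if_neg hA', if_neg hB, if_pos hB']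
        exact (hneC (heC _) hτ).symm
      · simp only [Φ, if_neg hA, if_neg hA', if_neg hB, if_neg hB']; exact hne
  have hval : ∀ τ ∈ S, β (Φ τ) ∈ C ∨ β (Φ τ) = τ := by
    intro τ hτ
    obtain ⟨x, hx⟩ := hβ (Φ τ) (hΦS τ hτ)
    rw [← hx]; exact hΦ τ x
  -- The `2q + 2` maps `Φ τ` have distinct `β`, and at most `2q` of these lie in `C`. Two maps
  -- remain with `β (Φ τ) = τ`, one of them with `τ ≠ s`.
  obtain ⟨τ, hτS, hτC, hτs, hβτ⟩ : ∃ τ ∈ S, τ ∉ C ∧ τ ≠ s ∧ β (Φ τ) = τ := by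
    have hT : (S \ C).card = 2 * q + 2 := by
      rw [Finset.card_sdiff_of_subset hCS]; omega
    have hbad : ((S \ C).filter fun τ => ¬ β (Φ τ) = τ).card ≤ C.card := by
      refine Finset.card_le_card_of_injOn (fun τ => β (Φ τ)) ?_ ?_
      · intro τ hτ
        have hτ' := Finset.mem_filter.1 hτ
        exact (hval τ (Finset.mem_sdiff.1 hτ'.1).1).resolve_right hτ'.2
      · intro τ hτ σ hσ h
        have hτ' := Finset.mem_sdiff.1 (Finset.mem_filter.1 hτ).1
        have hσ' := Finset.mem_sdiff.1 (Finset.mem_filter.1 hσ).1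
        by_contra hne
        exact hprop _ _ (hΦS τ hτ'.1) (hΦS σ hσ'.1) (hclique τ σ hτ'.2 hσ'.2 hne) h
    have hsum := Finset.card_filter_add_card_filter_not (s := S \ C) (fun τ => β (Φ τ) = τ)
    obtain ⟨τ, hτ, hne⟩ := Finset.exists_mem_ne
      (s := (S \ C).filter fun τ => β (Φ τ) = τ) (by omega) s
    have hτ' := Finset.mem_filter.1 hτ
    exact ⟨τ, (Finset.mem_sdiff.1 hτ'.1).1, (Finset.mem_sdiff.1 hτ'.1).2, hne, hτ'.2⟩
  -- `ν` is adjacent to `Φ τ`, which forbids `β ν = τ`, and to the robust map `f` avoiding `τ` and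
  -- `s` off `v`, which forbids `β ν = s`.
  let ν : V × Fin q → α := fun x => if x.1 = v ∨ B x.1 then τ else s
  have hνS : ∀ x, ν x ∈ S := by
    intro x; simp only [ν]; split_ifs <;> assumption
  have hνval : ∀ x, ν x = τ ∨ ν x = s := by
    intro x; simp only [ν]; split_ifs <;> simp
  obtain ⟨x, hx⟩ := hβ ν hνS
  rcases hνval x with h | h
  · refine hprop ν (Φ τ) hνS (hΦS τ hτS) ?_ (by rw [← hx, h, hβτ])
    rintro ⟨u, i⟩ ⟨u', j⟩ hadj
    have hadj' : G.Adj u u' ∨ u = u' := hadj.imp id And.left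
    by_cases hu : u = v ∨ B u
    · have h1 : ν (u, i) = τ := if_pos hu
      have h2 : Φ τ (u', j) ∈ C := by
        refine hΦC τ _ ?_
        rcases hu with rfl | hu
        · exact hadj'.elim Or.inr fun h => Or.inl (Or.inl h.symm)
        · exact hadj'.elim (fun h => Or.inl (Or.inr ⟨u, hu, h⟩)) fun h => Or.inr (h ▸ hu)
      rw [h1]
      exact fun h => hτC (h ▸ h2)
    · have h1 : ν (u, i) = s := if_neg hu
      rw [h1]
      intro h
      exact (hΦ τ (u', j)).elim (fun h2 => hsC (h ▸ h2)) fun h2 => hτs (h2.symm.trans h.symm)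
  · obtain ⟨f, hfS, hfv, hβf, hf⟩ := hrob τ
    refine hprop (fun x => f x.1) ν (fun x => hfS x.1) hνS ?_ (by rw [← hx, h]; exact hβf)
    rintro ⟨u, i⟩ ⟨u', j⟩ hadj
    have hadj' : G.Adj u u' ∨ u = u' := hadj.imp id And.left
    by_cases hu : u = v
    · have h1 : ν (u', j) = τ := by
        refine if_pos ?_
        subst hu
        exact hadj'.elim Or.inr fun h => Or.inl h.symm
      rw [h1]
      dsimp only
      rw [hu, hfv]
      exact hτs.symm
    · rcases hνval (u', j) with h1 | h1 <;> rw [h1]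
      · exact (hf u hu).1
      · exact (hf u hu).2

end Suited

/-! ### Bounds from the fractional chromatic number -/

section Fractional

variable {V : Type*} [Fintype V] {G : SimpleGraph V}

theorem IsFractionalColoring.total_nonneg {w : Finset V → ℝ} (hw : IsFractionalColoring G w) :
    0 ≤ ∑ I : Finset V, w I := Finset.sum_nonneg fun I _ => hw.1 I

theorem fractionalChromaticNumber_le {w : Finset V → ℝ} (hw : IsFractionalColoring G w) :
    fractionalChromaticNumber G ≤ ∑ I : Finset V, w I :=
  csInf_le ⟨0, by rintro r ⟨w, hw, rfl⟩; exact hw.total_nonneg⟩ ⟨w, hw, rfl⟩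

/-- Singletons of weight 1 suffice; the infimum defining `χ_f` is thus over a nonempty set. -/
theorem exists_isFractionalColoring (G : SimpleGraph V) : ∃ w, IsFractionalColoring G w := by
  classical
  refine ⟨fun I => if I.card = 1 then 1 else 0, fun I => ?_, fun I hI => ?_, fun v => ?_⟩
  · dsimp only; split_ifs <;> norm_num
  · have h1 : I.card = 1 := by by_contra h; simp [h] at hI
    obtain ⟨a, rfl⟩ := Finset.card_eq_one.1 h1
    simp [SimpleGraph.IsIndepSet]
  · refine le_trans (le_of_eq ?_) (Finset.single_le_sum (f := fun I : Finset V =>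
      if I.card = 1 then (1 : ℝ) else 0) (fun I _ => ?_) (a := {v}) ?_)
    · simp
    · split_ifs <;> norm_num
    · simp

/-- If each independent set meets `U` in at most `a` vertices, then `χ_f ≥ |U| / a`. -/
theorem card_le_mul_fractionalChromaticNumber (U : Finset V) (a : ℕ) (ha : 0 < a)
    (h : ∀ I : Finset V, G.IsIndepSet (I : Set V) → I ⊆ U → I.card ≤ a) :
    (U.card : ℝ) / a ≤ fractionalChromaticNumber G := by
  classical
  obtain ⟨w₀, hw₀⟩ := exists_isFractionalColoring G
  refine le_csInf ⟨_, w₀, hw₀, rfl⟩ ?_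
  rintro r ⟨w, hw, rfl⟩
  rw [div_le_iff₀ (by exact_mod_cast ha)]
  calc (U.card : ℝ) = ∑ v ∈ U, 1 := by simp
    _ ≤ ∑ v ∈ U, ∑ I : Finset V with v ∈ I, w I := Finset.sum_le_sum fun v _ => by
        convert hw.2.2 v
    _ = ∑ v ∈ U, ∑ I : Finset V, if v ∈ I then w I else 0 := by
        simp only [Finset.sum_filter]
    _ = ∑ I : Finset V, ∑ v ∈ U, if v ∈ I then w I else 0 := Finset.sum_comm
    _ = ∑ I : Finset V, ((U ∩ I).card : ℝ) * w I := by
        refine Finset.sum_congr rfl fun I _ => ?_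
        rw [← Finset.sum_filter, Finset.sum_const, nsmul_eq_mul, Finset.filter_mem_eq_inter]
    _ ≤ ∑ I : Finset V, (a : ℝ) * w I := by
        refine Finset.sum_le_sum fun I _ => ?_
        by_cases hI : w I = 0
        · simp [hI]
        · refine mul_le_mul_of_nonneg_right ?_ (hw.1 I)
          have := h (U ∩ I) ((hw.2.1 I hI).mono (by simp)) Finset.inter_subset_left
          exact_mod_cast this
    _ = (∑ I : Finset V, w I) * a := by rw [← Finset.mul_sum, mul_comm]

/-- `χ(G[K_q]) ≥ q χ_f(G)`. -/
theorem mul_fractionalChromaticNumber_le {q n : ℕ} (h : (cliqueBlowup G q).Colorable n) :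
    (q : ℝ) * fractionalChromaticNumber G ≤ n := by
  classical
  rcases Nat.eq_zero_or_pos q with rfl | hq
  · simp
  obtain ⟨C⟩ := h
  have hq' : (0 : ℝ) < q := by exact_mod_cast hq
  let J : Fin n → Finset V := fun c => Finset.univ.filter fun v => ∃ i, C (v, i) = c
  -- Each colour class, projected to `V`, gets weight `1/q`; summing over colours adds up coinciding
  -- projections.
  let w : Finset V → ℝ := fun I => ∑ c : Fin n, if J c = I then (1 : ℝ) / q else 0
  have hw : IsFractionalColoring G w := by
    refine ⟨fun I => Finset.sum_nonneg fun c _ => ?_, fun I hI => ?_, fun v => ?_⟩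
    · split_ifs <;> positivity
    · obtain ⟨c, -, hc⟩ := Finset.exists_ne_zero_of_sum_ne_zero hI
      have hJ : J c = I := by by_contra h; simp [h] at hc
      rw [← hJ]
      intro u hu v hv _ hadj
      simp only [J, Finset.coe_filter, Finset.mem_univ, true_and, Set.mem_ofPred_eq] at hu hv
      obtain ⟨i, hi⟩ := hu
      obtain ⟨j, hj⟩ := hv
      exact C.valid (v := (u, i)) (w := (v, j)) (Or.inl hadj) (hi.trans hj.symm)
    · have h1 : ∑ I : Finset V with v ∈ I, w I = ∑ c : Fin n, if v ∈ J c then (1 : ℝ) / q else 0 := by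
        rw [Finset.sum_comm]
        refine Finset.sum_congr rfl fun c _ => ?_
        rw [Finset.sum_ite_eq]
        simp
      have h2 : q ≤ (Finset.univ.filter fun c : Fin n => v ∈ J c).card := by
        have hinj : Function.Injective fun i : Fin q => C (v, i) := by
          intro i j hij
          by_contra hne
          exact C.valid (v := (v, i)) (w := (v, j)) (Or.inr ⟨rfl, hne⟩) hij
        calc q = (Finset.univ.image fun i : Fin q => C (v, i)).card := by
              rw [Finset.card_image_of_injective _ hinj, Finset.card_univ, Fintype.card_fin]
          _ ≤ _ := Finset.card_le_card fun c hc => by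
              obtain ⟨i, -, rfl⟩ := Finset.mem_image.1 hc
              simp [J]
      have h3 : (1 : ℝ) ≤ ∑ I : Finset V with v ∈ I, w I := by
        rw [h1, ← Finset.sum_filter, Finset.sum_const, nsmul_eq_mul, mul_one_div,
          one_le_div hq']
        exact_mod_cast h2
      convert h3
  have htot : ∑ I : Finset V, w I = n / q := by
    rw [Finset.sum_comm]
    simp [div_eq_mul_inv]
  have := fractionalChromaticNumber_le hw
  rw [htot, le_div_iff₀ hq'] at this
  linarith

end Fractional

/-! ### Colourings of the exponential graph -/

section Exponential

/-- Evaluation properly colours the product with `m` colours. `H` is moved to `Fin` because the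
values of `f` range over graphs on `Type`. -/
theorem poljakRodl_le {W : Type*} [Fintype W] (H : SimpleGraph W) {n m : ℕ}
    (h1 : (n : ℕ∞) ≤ H.chromaticNumber) (h2 : (n : ℕ∞) ≤ (expGraph H m).chromaticNumber) :
    poljakRodl n ≤ m := by
  classical
  let e : Fin (Fintype.card W) ≃ W := (Fintype.equivFin W).symm
  let H' : SimpleGraph (Fin (Fintype.card W)) := H.comap e
  have hH : (n : ℕ∞) ≤ H'.chromaticNumber :=
    h1.trans (SimpleGraph.chromaticNumber_mono_of_hom
      ⟨e.symm, fun {a b} hab => by simpa [H'] using hab⟩)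
  have hE : (n : ℕ∞) ≤ (expGraph H' m).chromaticNumber := by
    refine h2.trans (SimpleGraph.chromaticNumber_mono_of_hom
      ⟨fun f => f ∘ e, fun {f g} hfg => ⟨fun h => hfg.1 ?_, fun x y hxy => hfg.2 _ _ hxy⟩⟩)
    exact e.surjective.injective_comp_right h
  have hcol : (graphProduct H' (expGraph H' m)).Colorable m :=
    ⟨SimpleGraph.Coloring.mk (fun x => x.2 x.1) fun {x y} hxy => hxy.2.2 _ _ hxy.1⟩
  have hle := hcol.chromaticNumber_le
  obtain ⟨k, hk⟩ := ENat.ne_top_iff_exists.1 (ne_top_of_le_ne_top (ENat.natCast_ne_top m) hle)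
  rw [← hk] at hle
  refine (Nat.sInf_le ?_).trans (Nat.cast_le.1 hle)
  exact ⟨_, _, inferInstance, inferInstance, H', expGraph H' m, hH, hE, hk.symm⟩

theorem le_chromaticNumber_expGraph {V : Type*} [Fintype V] {G : SimpleGraph V}
    (hg : 6 ≤ G.egirth) {q c d : ℕ} (hV : Nonempty V) (hq : Fintype.card V ^ 2 ≤ q)
    (hc : c = 4 * q + 2) (hd : 1 ≤ d)
    (hloop : ∀ φ : V × Fin q → Fin (d * c), ¬ ExpAdj (cliqueBlowup G q) (d * c) φ φ) :
    ((2 * d * c - 2 * c + 2 : ℕ) : ℕ∞) ≤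
      (expGraph (cliqueBlowup G q) (d * c)).chromaticNumber := by
  classical
  by_contra hlt
  rw [not_le] at hlt
  obtain ⟨k, hk⟩ := ENat.ne_top_iff_exists.1 hlt.ne_top
  have hkc : (expGraph (cliqueBlowup G q) (d * c)).Colorable k :=
    SimpleGraph.chromaticNumber_le_iff_colorable.1 hk.symm.le
  rw [← hk, Nat.cast_lt] at hlt
  obtain ⟨Ψ⟩ := hkc
  have hval : ∀ φ ψ : V × Fin q → Fin (d * c), ExpAdj (cliqueBlowup G q) (d * c) φ ψ →
      Ψ φ ≠ Ψ ψ := fun φ ψ h => Ψ.valid ⟨fun he => hloop ψ (he ▸ h), h⟩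
  have hq0 : 0 < q := by
    have : 0 < Fintype.card V := Fintype.card_pos
    have : 0 < Fintype.card V ^ 2 := by positivity
    omega
  have : Nonempty (Fin (d * c)) := ⟨⟨0, Nat.mul_pos hd (by omega)⟩⟩
  have : Nonempty (V × Fin q) := hV.elim fun v => ⟨(v, ⟨0, hq0⟩)⟩
  let K : Fin (d * c) → Fin k := fun b => Ψ fun _ => b
  have hK : Function.Injective K := by
    intro a b hab
    by_contra hne
    exact hval _ _ (fun _ _ _ => hne) hab
  let R : Finset (Fin k) := Finset.univ \ Finset.univ.image K
  have hR : R.card + d * c = k := by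
    have h1 : (Finset.univ.image K).card = d * c := by
      rw [Finset.card_image_of_injective _ hK, Finset.card_univ, Fintype.card_fin]
    have h2 := Finset.card_sdiff_add_card_eq_card (Finset.subset_univ (Finset.univ.image K))
    rw [h1, Finset.card_univ, Fintype.card_fin] at h2
    exact h2
  -- Without free colours on `S`, each map has the colour of a constant map `β φ`, and adjacency
  -- forces `φ` to attain that value.
  have hsec : ∀ S : Finset (Fin (d * c)), S.card = c →
      ∃ φ : V × Fin q → Fin (d * c), (∀ x, φ x ∈ S) ∧ Ψ φ ∈ R := by
    intro S hS
    by_contra hno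
    have hno' : ∀ φ : V × Fin q → Fin (d * c), (∀ x, φ x ∈ S) → ∃ b, K b = Ψ φ := by
      intro φ hφ
      by_contra hb
      exact hno ⟨φ, hφ, by simpa [R] using hb⟩
    choose! β hβ using hno'
    refine not_suited hg hq (hS.trans hc) β (fun φ hφ => ?_) fun φ ψ hφ hψ hadj heq => ?_
    · by_contra hx
      push Not at hx
      exact hval φ (fun _ => β φ) (fun x _ _ => hx x) (hβ φ hφ).symm
    · exact hval φ ψ hadj (by rw [← hβ φ hφ, ← hβ ψ hψ, heq])
  choose! Φ hΦS hΦR using hsec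
  let κ : Finset (Fin (d * c)) → ℕ := fun S =>
    if h : Ψ (Φ S) ∈ R then R.equivFin ⟨_, h⟩ else 0
  have hdc : d * c + 2 * c ≤ 2 * d * c ∨ d = 1 := by
    rcases hd.eq_or_lt with h | h
    · exact Or.inr h.symm
    · left; nlinarith
  rcases hdc with hdc | rfl
  swap
  -- For `d = 1` the bound is 2, while the constant maps alone need `c > 2` colours.
  · have : 2 * 1 * c - 2 * c + 2 = 2 := by omega
    rw [this] at hlt
    omega
  obtain ⟨F, F', hF, hF', hdisj, heq⟩ := exists_disjoint_same_colour (n := d * c) c κ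
    (t := R.card) (by omega)
    (by
      have : 2 * d * c = d * c + d * c := by ring
      omega)
    (fun F hF => by
      simp only [κ, dif_pos (hΦR F hF)]
      exact Fin.is_lt _)
  simp only [κ, dif_pos (hΦR F hF), dif_pos (hΦR F' hF')] at heq
  have h1 := R.equivFin.injective (Fin.ext heq)
  refine hval (Φ F) (Φ F') (fun x y _ h => ?_) (congrArg Subtype.val h1)
  exact Finset.disjoint_left.1 hdisj (hΦS F hF x) (h ▸ hΦS F' hF' y)

theorem blowup_bounds {d : ℕ} (hd : 1 ≤ d) {V : Type*} [Fintype V] {G : SimpleGraph V}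
    (hg : 6 ≤ G.egirth) (hf : (8.1 : ℝ) * (d : ℝ) ≤ fractionalChromaticNumber G) {q c : ℕ}
    (hq : Fintype.card V ^ 2 ≤ q) (hc : c = 4 * q + 2) :
    ((2 * d * c - 2 * c + 2 : ℕ) : ℕ∞) ≤ (cliqueBlowup G q).chromaticNumber ∧
      (∀ φ : V × Fin q → Fin (d * c), ¬ ExpAdj (cliqueBlowup G q) (d * c) φ φ) ∧
      ((2 * d * c - 2 * c + 2 : ℕ) : ℕ∞) ≤
        (expGraph (cliqueBlowup G q) (d * c)).chromaticNumber ∧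
      poljakRodl (2 * d * c - 2 * c + 2) ≤ d * c := by
  have hd' : (1 : ℝ) ≤ d := by exact_mod_cast hd
  have hcardV : (8.1 : ℝ) * d ≤ Fintype.card V := by
    have h1 : (cliqueBlowup G 1).Colorable (Fintype.card (V × Fin 1)) :=
      SimpleGraph.colorable_of_fintype _
    have h2 := mul_fractionalChromaticNumber_le h1
    simp at h2
    linarith
  -- With `q ≥ d`, the terms linear in `d` are absorbed: `2dc - 2c + 2 = 8dq - 8q + 4d - 2` stays
  -- below `8.1 dq`.
  have hqd : (8.1 : ℝ) * d ≤ q := by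
    have h1 : ((Fintype.card V : ℝ)) ^ 2 ≤ q := by exact_mod_cast hq
    nlinarith
  have hV : Nonempty V := by
    rw [← Fintype.card_pos_iff]
    by_contra h
    have : Fintype.card V = 0 := by omega
    rw [this] at hcardV
    norm_num at hcardV
    linarith
  have hcolor : ∀ n, (cliqueBlowup G q).Colorable n → (8.1 : ℝ) * d * q ≤ n := by
    intro n hn
    have h1 := mul_fractionalChromaticNumber_le hn
    have h2 : (0 : ℝ) ≤ q := Nat.cast_nonneg q
    nlinarith
  have hdq : (q : ℝ) ≤ d * q := by nlinarith
  have hblow : ((2 * d * c - 2 * c + 2 : ℕ) : ℕ∞) ≤ (cliqueBlowup G q).chromaticNumber := by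
    rw [SimpleGraph.le_chromaticNumber_iff_colorable]
    intro n hn
    have h1 := hcolor n hn
    have h2 : 2 * c ≤ 2 * d * c := by nlinarith
    refine Nat.cast_le.2 ?_
    have h3 : ((2 * d * c - 2 * c + 2 : ℕ) : ℝ) ≤ n := by
      have h4 : (c : ℝ) = 4 * q + 2 := by rw [hc]; push_cast; ring
      push_cast [Nat.cast_sub h2]
      rw [h4]
      nlinarith
    exact_mod_cast h3
  have hloop : ∀ φ : V × Fin q → Fin (d * c), ¬ ExpAdj (cliqueBlowup G q) (d * c) φ φ := by
    intro φ hφ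
    have h1 := hcolor (d * c) ⟨SimpleGraph.Coloring.mk φ fun {x y} hxy => hφ x y hxy⟩
    rw [hc] at h1
    push_cast at h1
    nlinarith
  have hexp := le_chromaticNumber_expGraph hg hV hq hc hd hloop
  exact ⟨hblow, hloop, hexp, poljakRodl_le _ hblow hexp⟩

end Exponential

/-! ### Cycles as maps, and girth exactly six -/

/-- The cyclic successor of `j`. -/
def cyclicSucc {l : ℕ} (j : Fin l) : Fin l := ⟨((j : ℕ) + 1) % l, Nat.mod_lt _ j.pos⟩

/-- `x` lists the vertices of a cycle in `G`. -/
def IsCycleMap {V : Type*} (G : SimpleGraph V) {l : ℕ} (x : Fin l → V) : Prop :=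
  Function.Injective x ∧ ∀ j, G.Adj (x j) (x (cyclicSucc j))

theorem six_le_egirth_of_not_isCycleMap {V : Type*} {G : SimpleGraph V}
    (h : ∀ l, 3 ≤ l → l < 6 → ∀ x : Fin l → V, ¬ IsCycleMap G x) : 6 ≤ G.egirth := by
  rw [SimpleGraph.le_egirth]
  intro a w hw
  by_contra hlt
  have hlt' : w.length < 6 := by
    rw [not_le] at hlt
    exact_mod_cast hlt
  refine h w.length hw.three_le_length hlt' (fun j => w.getVert j) ⟨?_, ?_⟩
  · intro i j hij
    exact Fin.ext (hw.getVert_injOn' (by simp only [Set.mem_ofPred_eq]; omega)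
      (by simp only [Set.mem_ofPred_eq]; omega) hij)
  · intro j
    have hadj := w.adj_getVert_succ j.2
    by_cases hj : (j : ℕ) + 1 < w.length
    · simpa only [cyclicSucc, Nat.mod_eq_of_lt hj] using hadj
    · have hj' : (j : ℕ) + 1 = w.length := by omega
      simp only [cyclicSucc, hj', Nat.mod_self, SimpleGraph.Walk.getVert_zero]
      rwa [hj', SimpleGraph.Walk.getVert_length] at hadj

/-- Two positions with the same edge reversed would be successors of each other, which needs length
at most 2. -/
theorem IsCycleMap.edge_injective {V : Type*} {G : SimpleGraph V} {l : ℕ} (hl : 3 ≤ l)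
    {x : Fin l → V} (hx : IsCycleMap G x) :
    Function.Injective fun j => s(x j, x (cyclicSucc j)) := by
  intro j j' h
  rcases Sym2.eq_iff.1 h with h | h
  · exact hx.1 h.1
  · have h1 := congrArg Fin.val (hx.1 h.1)
    have h2 := congrArg Fin.val (hx.1 h.2)
    simp only [cyclicSucc] at h1 h2
    exfalso
    have hj := j.2
    have hj' := j'.2
    rcases Nat.lt_or_ge ((j : ℕ) + 1) l with h3 | h3
    · rw [Nat.mod_eq_of_lt h3] at h2
      rcases Nat.lt_or_ge ((j' : ℕ) + 1) l with h4 | h4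
      · rw [Nat.mod_eq_of_lt h4] at h1; omega
      · rw [show (j' : ℕ) + 1 = l by omega, Nat.mod_self] at h1; omega
    · rw [show (j : ℕ) + 1 = l by omega, Nat.mod_self] at h2
      rw [Nat.mod_eq_of_lt (by omega)] at h1; omega

section SumGraph

variable {V W : Type*} {G : SimpleGraph V} {H : SimpleGraph W}

theorem isCycleMap_sum {l : ℕ} {x : Fin l → V ⊕ W} (hl : 0 < l) (hx : IsCycleMap (G ⊕g H) x) :
    (∃ y : Fin l → V, IsCycleMap G y) ∨ ∃ y : Fin l → W, IsCycleMap H y := by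
  have hside : ∀ j (hj : j < l), (x ⟨j, hj⟩).isLeft = (x ⟨0, hl⟩).isLeft := by
    intro j
    induction j with
    | zero => intro _; rfl
    | succ j ih =>
      intro hj
      rw [← ih (by omega)]
      have := hx.2 ⟨j, by omega⟩
      simp only [cyclicSucc, Nat.mod_eq_of_lt hj] at this
      revert this
      cases x ⟨j, by omega⟩ <;> cases x ⟨j + 1, hj⟩ <;> simp
  cases h0 : (x ⟨0, hl⟩).isLeft
  · right
    have : ∀ j : Fin l, ∃ y, x j = Sum.inr y := by
      intro j
      have h1 := hside j j.2
      rw [h0] at h1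
      exact Sum.isRight_iff.1 (by simpa using h1)
    choose y hy using this
    refine ⟨y, fun i j hij => hx.1 (by rw [hy, hy, hij]), fun j => ?_⟩
    have := hx.2 j
    rw [hy, hy] at this
    simpa using this
  · left
    have : ∀ j : Fin l, ∃ y, x j = Sum.inl y := by
      intro j
      have h1 := hside j j.2
      rw [h0] at h1
      exact Sum.isLeft_iff.1 h1
    choose y hy using this
    refine ⟨y, fun i j hij => hx.1 (by rw [hy, hy, hij]), fun j => ?_⟩
    have := hx.2 j
    rw [hy, hy] at this
    simpa using this

theorem not_isCycleMap_cycleGraph_six {l : ℕ} (h3 : 3 ≤ l) (h6 : l < 6) (x : Fin l → Fin 6) :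
    ¬ IsCycleMap (SimpleGraph.cycleGraph 6) x := by
  rintro ⟨hinj, hadj⟩
  have key : ∀ a b : Fin 6, (SimpleGraph.cycleGraph 6).Adj a b → b = a + 1 ∨ b = a + 5 := by
    intro a b h
    rw [SimpleGraph.cycleGraph_adj] at h
    revert a b; decide
  have step := fun j => key _ _ (hadj j)
  interval_cases l
  · have d3 : ∀ a b : Fin 6, (b = a + 1 ∨ b = a + 5) → ∀ c, (c = b + 1 ∨ c = b + 5) →
        ¬ (a = c + 1 ∨ a = c + 5) := by decide
    exact d3 _ _ (step 0) _ (step 1) (step 2)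
  -- Odd lengths fail by parity alone; length 4 also needs backtracking excluded.
  · have d4 : ∀ a b : Fin 6, (b = a + 1 ∨ b = a + 5) → ∀ c, (c = b + 1 ∨ c = b + 5) ∧ c ≠ a →
        ∀ d, (d = c + 1 ∨ d = c + 5) ∧ d ≠ b → ¬ (a = d + 1 ∨ a = d + 5) := by decide
    exact d4 _ _ (step 0) _ ⟨step 1, hinj.ne (by decide)⟩ _ ⟨step 2, hinj.ne (by decide)⟩
      (step 3)
  · have d5 : ∀ a b : Fin 6, (b = a + 1 ∨ b = a + 5) → ∀ c, (c = b + 1 ∨ c = b + 5) →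
        ∀ d, (d = c + 1 ∨ d = c + 5) → ∀ e, (e = d + 1 ∨ e = d + 5) →
        ¬ (a = e + 1 ∨ a = e + 5) := by decide
    exact d5 _ _ (step 0) _ (step 1) _ (step 2) _ (step 3) (step 4)

/-- A disjoint hexagon makes the girth exactly 6 and creates no shorter cycle. -/
theorem egirth_sum_cycleGraph_six
    (h : ∀ l, 3 ≤ l → l < 6 → ∀ x : Fin l → V, ¬ IsCycleMap G x) :
    (G ⊕g SimpleGraph.cycleGraph 6).egirth = 6 := by
  refine le_antisymm ?_ (six_le_egirth_of_not_isCycleMap fun l h3 h6 x hx => ?_)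
  · have hc := (SimpleGraph.cycleGraph.isCycle_cycle (n := 3)).map
      (f := (SimpleGraph.Embedding.sumInr (G := G) (H := SimpleGraph.cycleGraph 6)).toHom)
      (SimpleGraph.Embedding.sumInr (G := G) (H := SimpleGraph.cycleGraph 6)).injective
    have := SimpleGraph.egirth_le_length hc
    rw [SimpleGraph.Walk.length_map, SimpleGraph.cycleGraph.length_cycle] at this
    exact this
  · rcases isCycleMap_sum (by omega) hx with ⟨y, hy⟩ | ⟨y, hy⟩
    · exact h l h3 h6 y hy
    · exact not_isCycleMap_cycleGraph_six h3 h6 y hy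

end SumGraph

/-! ### Erdős's random graphs of large girth -/

section Random

variable {V : Type*} {M : ℕ}

/-- The graph whose edges are the pairs of distinct vertices listed by `e`. -/
def pairGraph (e : Fin M → V × V) : SimpleGraph V :=
  SimpleGraph.fromRel fun x y => ∃ i, e i = (x, y)

theorem exists_of_pairGraph_adj {e : Fin M → V × V} {x y : V} (h : (pairGraph e).Adj x y) :
    ∃ (i : Fin M) (b : Bool), e i = if b then (x, y) else (y, x) := by
  rw [pairGraph, SimpleGraph.fromRel_adj] at h
  rcases h.2 with ⟨i, hi⟩ | ⟨i, hi⟩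
  · exact ⟨i, true, by simpa using hi⟩
  · exact ⟨i, false, by simpa using hi⟩

variable [Fintype V] [DecidableEq V]

/-- The pairs that form the cycle through `x`, with orientations `o`. -/
def orientedEdge {l : ℕ} (x : Fin l → V) (o : Fin l → Bool) (j : Fin l) : V × V :=
  if o j then (x j, x (cyclicSucc j)) else (x (cyclicSucc j), x j)

/-- The cycles of length `l` in `pairGraph e`, with the places in the list `e` of their edges. -/
def cycleWitnesses (e : Fin M → V × V) (l : ℕ) :
    Finset ((Fin l → V) × (Fin l → Fin M) × (Fin l → Bool)) :=
  Finset.univ.filter fun t => Function.Injective t.2.1 ∧ ∀ j, e (t.2.1 j) = orientedEdge t.1 t.2.2 j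

theorem IsCycleMap.exists_mem_cycleWitnesses {e : Fin M → V × V} {l : ℕ} (hl : 3 ≤ l)
    {x : Fin l → V} (hx : IsCycleMap (pairGraph e) x) : ∃ i o, (x, i, o) ∈ cycleWitnesses e l := by
  choose i o h using fun j => exists_of_pairGraph_adj (hx.2 j)
  refine ⟨i, o, ?_⟩
  rw [cycleWitnesses, Finset.mem_filter]
  refine ⟨Finset.mem_univ _, fun j j' hj => hx.edge_injective hl ?_, h⟩
  have h1 : ∀ j, Sym2.mk (e (i j)).1 (e (i j)).2 = s(x j, x (cyclicSucc j)) := by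
    intro j
    rw [h j]
    cases o j
    · exact Sym2.eq_swap
    · rfl
  have h2 := h1 j
  dsimp only at hj
  rw [hj, h1 j'] at h2
  exact h2.symm

/-- A uniformly random list has prescribed entries at `l` distinct places with probability at most
`|V × V|⁻ˡ`. -/
theorem card_pow_mul_card_prescribed {l : ℕ} (i : Fin l → Fin M) (hi : Function.Injective i)
    (z : Fin l → V × V) :
    Fintype.card (V × V) ^ l *
      (Finset.univ.filter fun e : Fin M → V × V => ∀ j, e (i j) = z j).card ≤
      Fintype.card (V × V) ^ M := by
  set T := Fintype.card (V × V) with hT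
  have hsub : (Finset.univ.filter fun e : Fin M → V × V => ∀ j, e (i j) = z j) ⊆
      Fintype.piFinset fun m : Fin M => Finset.univ.filter fun y => ∀ j, i j = m → y = z j := by
    intro e he
    rw [Finset.mem_filter] at he
    rw [Fintype.mem_piFinset]
    intro m
    rw [Finset.mem_filter]
    exact ⟨Finset.mem_univ _, fun j hj => hj ▸ he.2 j⟩
  let R : Finset (Fin M) := Finset.univ.image i
  have hR : R.card = l := by
    rw [Finset.card_image_of_injective _ hi, Finset.card_univ, Fintype.card_fin]
  have hRc : R.card + Rᶜ.card = M := by rw [Finset.card_add_card_compl, Fintype.card_fin]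
  calc _ ≤ T ^ l * ∏ m : Fin M,
          (Finset.univ.filter fun y : V × V => ∀ j, i j = m → y = z j).card := by
        rw [← Fintype.card_piFinset]
        exact Nat.mul_le_mul_left _ (Finset.card_le_card hsub)
    _ = T ^ l * ((∏ m ∈ R, (Finset.univ.filter fun y : V × V => ∀ j, i j = m → y = z j).card) *
          ∏ m ∈ Rᶜ, (Finset.univ.filter fun y : V × V => ∀ j, i j = m → y = z j).card) := by
        rw [Finset.prod_mul_prod_compl]
    _ ≤ T ^ l * ((∏ m ∈ R, 1) * ∏ m ∈ Rᶜ, T) := by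
        refine Nat.mul_le_mul_left _ (Nat.mul_le_mul
          (Finset.prod_le_prod' fun m hm => ?_) (Finset.prod_le_prod' fun m _ => ?_))
        · obtain ⟨j, -, rfl⟩ := Finset.mem_image.1 hm
          rw [Finset.card_le_one]
          intro a ha b hb
          rw [(Finset.mem_filter.1 ha).2 j rfl, (Finset.mem_filter.1 hb).2 j rfl]
        · exact Finset.card_le_univ _
    _ = T ^ M := by
        rw [Finset.prod_const_one, one_mul, Finset.prod_const, ← pow_add, ← hR, hRc]

/-- First moment: `N^l M^l 2^l` candidates of probability at most `N^(-2l)` give `(2k)^l`,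
independent of `N`. -/
theorem sum_card_cycleWitnesses_le {l k : ℕ} (hM : M = k * Fintype.card V)
    (hV : 0 < Fintype.card V) :
    ∑ e : Fin M → V × V, (cycleWitnesses e l).card ≤
      (2 * k) ^ l * Fintype.card (V × V) ^ M := by
  set N := Fintype.card V with hN
  have hT : Fintype.card (V × V) = N * N := by rw [Fintype.card_prod]
  have hswap : ∑ e : Fin M → V × V, (cycleWitnesses e l).card =
      ∑ t : (Fin l → V) × (Fin l → Fin M) × (Fin l → Bool), (Finset.univ.filter
        fun e : Fin M → V × V => Function.Injective t.2.1 ∧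
          ∀ j, e (t.2.1 j) = orientedEdge t.1 t.2.2 j).card := by
    simp only [cycleWitnesses, Finset.card_filter]
    exact Finset.sum_comm
  have hterm : ∀ t : (Fin l → V) × (Fin l → Fin M) × (Fin l → Bool),
      Fintype.card (V × V) ^ l * (Finset.univ.filter
        fun e : Fin M → V × V => Function.Injective t.2.1 ∧
          ∀ j, e (t.2.1 j) = orientedEdge t.1 t.2.2 j).card ≤ Fintype.card (V × V) ^ M := by
    intro t
    by_cases hi : Function.Injective t.2.1
    · simpa [hi] using card_pow_mul_card_prescribed t.2.1 hi (orientedEdge t.1 t.2.2)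
    · simp [hi]
  have hpos : 0 < (N * N) ^ l := by positivity
  refine Nat.le_of_mul_le_mul_left ?_ hpos
  rw [hswap]
  calc (N * N) ^ l * _ ≤ ∑ t : (Fin l → V) × (Fin l → Fin M) × (Fin l → Bool),
          Fintype.card (V × V) ^ M := by
        rw [← hT, Finset.mul_sum]
        exact Finset.sum_le_sum fun t _ => hterm t
    _ = (N ^ l * (M ^ l * 2 ^ l)) * Fintype.card (V × V) ^ M := by
        simp [Fintype.card_prod, ← hN]
    _ = (N * N) ^ l * ((2 * k) ^ l * Fintype.card (V × V) ^ M) := by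
        rw [hM]; simp only [mul_pow]; ring

/-- The independent sets of `a` vertices in `pairGraph e`. -/
noncomputable def indepWitnesses (e : Fin M → V × V) (a : ℕ) : Finset (Finset V) :=
  open Classical in
  Finset.univ.filter fun S => S.card = a ∧ (pairGraph e).IsIndepSet (S : Set V)

/-- Union bound: the list must avoid the `a (a - 1)` ordered pairs inside the set. -/
theorem sum_card_indepWitnesses_le (a : ℕ) :
    ∑ e : Fin M → V × V, (indepWitnesses e a).card ≤
      2 ^ Fintype.card V * (Fintype.card V * Fintype.card V - a * (a - 1)) ^ M := by
  classical
  set N := Fintype.card V with hN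
  have hterm : ∀ S : Finset V, (Finset.univ.filter fun e : Fin M → V × V =>
      S.card = a ∧ (pairGraph e).IsIndepSet (S : Set V)).card ≤ (N * N - a * (a - 1)) ^ M := by
    intro S
    by_cases hS : S.card = a
    · have hsub : (Finset.univ.filter fun e : Fin M → V × V =>
          S.card = a ∧ (pairGraph e).IsIndepSet (S : Set V)) ⊆
          Fintype.piFinset fun _ : Fin M => S.offDiagᶜ := by
        intro e he
        rw [Finset.mem_filter] at he
        rw [Fintype.mem_piFinset]
        intro m
        rw [Finset.mem_compl, Finset.mem_offDiag]
        rintro ⟨h1, h2, h3⟩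
        refine he.2.2 h1 h2 h3 ?_
        rw [pairGraph, SimpleGraph.fromRel_adj]
        exact ⟨h3, Or.inl ⟨m, rfl⟩⟩
      refine (Finset.card_le_card hsub).trans (le_of_eq ?_)
      rw [Fintype.card_piFinset, Finset.prod_const, Finset.card_univ, Fintype.card_fin,
        Finset.card_compl, Finset.offDiag_card, Fintype.card_prod, hS, Nat.mul_sub, Nat.mul_one]
    · simp [hS]
  calc ∑ e : Fin M → V × V, (indepWitnesses e a).card
      = ∑ S : Finset V, (Finset.univ.filter fun e : Fin M → V × V =>
          S.card = a ∧ (pairGraph e).IsIndepSet (S : Set V)).card := by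
        simp only [indepWitnesses, Finset.card_filter]
        exact Finset.sum_comm
    _ ≤ ∑ S : Finset V, (N * N - a * (a - 1)) ^ M := Finset.sum_le_sum fun S _ => hterm S
    _ = _ := by simp [hN]

end Random

/-- As `a - 1 ≥ a/2`, one pair is avoided with probability at most `1 - 1/y`, `y = 8K²`. The
exponent is `2yN` and `(1 - 1/y)^y ≤ 1/e ≤ 1/2`, so `4^(-N)` beats `2^N`. -/
theorem indep_bound {K a : ℕ} (hK : 1 ≤ K) (ha : 2 ≤ a) :
    (2 : ℝ) ^ (2 * K * a) *
      (((2 * K * a) * (2 * K * a) - a * (a - 1) : ℕ) : ℝ) ^ (16 * K ^ 2 * (2 * K * a)) ≤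
      (1 / 2) * (((2 * K * a) * (2 * K * a) : ℕ) : ℝ) ^ (16 * K ^ 2 * (2 * K * a)) := by
  set N := 2 * K * a with hN
  set y := 8 * K ^ 2 with hy
  have hy1 : 1 ≤ y := by nlinarith
  have hN1 : 1 ≤ N := by nlinarith
  have hyR : (1 : ℝ) ≤ y := by exact_mod_cast hy1
  have hbase : ((N * N - a * (a - 1) : ℕ) : ℝ) ≤ ((N * N : ℕ) : ℝ) * (1 - 1 / y) := by
    have h1 : a * (a - 1) ≤ N * N := Nat.mul_le_mul (by nlinarith) (by
      have : a ≤ N := by nlinarith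
      omega)
    have h3 : (2 : ℝ) ≤ a := by exact_mod_cast ha
    rw [Nat.cast_sub h1, mul_sub, mul_one, mul_one_div]
    refine sub_le_sub_left ?_ _
    rw [div_le_iff₀ (by linarith)]
    have h4 : ((N * N : ℕ) : ℝ) = 4 * K ^ 2 * a ^ 2 := by rw [hN]; push_cast; ring
    have h5 : ((a * (a - 1) : ℕ) : ℝ) = a * (a - 1) := by
      rw [Nat.cast_mul, Nat.cast_sub (by omega), Nat.cast_one]
    rw [h4, h5, hy]
    push_cast
    have h6 : (0 : ℝ) ≤ K ^ 2 * a * (a - 2) := by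
      have : (0 : ℝ) ≤ a - 2 := by linarith
      positivity
    nlinarith
  have hpow : (1 - 1 / (y : ℝ)) ^ y ≤ 1 / 2 := by
    refine (Real.one_sub_div_pow_le_exp_neg hyR).trans ?_
    rw [Real.exp_neg, one_div]
    refine inv_anti₀ (by norm_num) ?_
    have := Real.exp_one_gt_d9
    linarith
  have h0 : (0 : ℝ) ≤ 1 - 1 / y := by
    rw [sub_nonneg, div_le_one (by linarith)]; exact hyR
  calc (2 : ℝ) ^ N * ((N * N - a * (a - 1) : ℕ) : ℝ) ^ (16 * K ^ 2 * N)
      ≤ 2 ^ N * (((N * N : ℕ) : ℝ) * (1 - 1 / y)) ^ (16 * K ^ 2 * N) := by gcongr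
    _ = 2 ^ N * ((1 - 1 / (y : ℝ)) ^ y) ^ (2 * N) * ((N * N : ℕ) : ℝ) ^ (16 * K ^ 2 * N) := by
        rw [mul_pow, ← pow_mul, show y * (2 * N) = 16 * K ^ 2 * N by rw [hy]; ring]; ring
    _ ≤ 2 ^ N * (1 / 2) ^ (2 * N) * ((N * N : ℕ) : ℝ) ^ (16 * K ^ 2 * N) := by gcongr
    _ = (1 / 2) ^ N * ((N * N : ℕ) : ℝ) ^ (16 * K ^ 2 * N) := by
        rw [mul_comm 2 N, pow_mul (1 / 2 : ℝ), pow_two, ← mul_assoc, ← mul_pow]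
        norm_num
    _ ≤ (1 / 2) * ((N * N : ℕ) : ℝ) ^ (16 * K ^ 2 * N) := by
        gcongr
        calc (1 / 2 : ℝ) ^ N ≤ (1 / 2) ^ 1 :=
              pow_le_pow_of_le_one (by norm_num) (by norm_num) hN1
          _ = 1 / 2 := pow_one _

/-- Erdős' theorem, for cycles of length at most five. -/
theorem exists_sparse_pairGraph {K a N : ℕ} (hN : N = 2 * K * a) (hK : 1 ≤ K) (ha2 : 2 ≤ a)
    (ha : 12 * (2 * (16 * K ^ 2)) ^ 5 < a) :
    ∃ (M : ℕ) (e : Fin M → Fin N × Fin N),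
      2 * ∑ l ∈ Finset.Ico 3 6, (cycleWitnesses e l).card < N ∧
      indepWitnesses e a = ∅ := by
  obtain ⟨k, hk⟩ : ∃ k, k = 16 * K ^ 2 := ⟨_, rfl⟩
  obtain ⟨M, hM⟩ : ∃ M, M = k * N := ⟨_, rfl⟩
  rw [← hk] at ha
  have hN1 : 1 ≤ N := by nlinarith
  have hNR : (0 : ℝ) < N := by exact_mod_cast hN1
  have haN : a ≤ N := by nlinarith
  obtain ⟨T, hT⟩ : ∃ T : ℝ, T = ((N * N : ℕ) : ℝ) ^ M := ⟨_, rfl⟩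
  have hTpos : 0 < T := by rw [hT]; positivity
  have hk1 : 1 ≤ 2 * k := by nlinarith
  have hcyc : ∑ e : Fin M → Fin N × Fin N,
      (∑ l ∈ Finset.Ico 3 6, ((cycleWitnesses e l).card : ℝ)) ≤ 3 * (2 * k : ℕ) ^ 5 * T := by
    rw [Finset.sum_comm]
    calc _ ≤ ∑ l ∈ Finset.Ico 3 6, ((2 * k : ℕ) : ℝ) ^ 5 * T := by
          refine Finset.sum_le_sum fun l hl => ?_
          have h1 := sum_card_cycleWitnesses_le (V := Fin N) (M := M) (l := l) (k := k)
            (by rw [Fintype.card_fin, hM]) (by rw [Fintype.card_fin]; exact hN1)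
          rw [Fintype.card_prod, Fintype.card_fin] at h1
          have h2 : (∑ e : Fin M → Fin N × Fin N, ((cycleWitnesses e l).card : ℝ)) ≤
              ((2 * k : ℕ) : ℝ) ^ l * T := by rw [hT]; exact_mod_cast h1
          refine h2.trans ?_
          gcongr
          · exact_mod_cast hk1
          · have := (Finset.mem_Ico.1 hl).2; omega
      _ = _ := by simp; ring
  have hind : ∑ e : Fin M → Fin N × Fin N, ((indepWitnesses e a).card : ℝ) ≤ 1 / 2 * T := by
    have h1 := sum_card_indepWitnesses_le (V := Fin N) (M := M) a
    rw [Fintype.card_fin] at h1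
    have h2 := indep_bound hK ha2
    rw [← hN, ← hk, ← hM, ← hT] at h2
    refine le_trans ?_ h2
    exact_mod_cast h1
  -- The weighted mean is below 1: the cycle part is below 1/2 because `N > 12 (2k)^5`. A list below
  -- the mean bound meets both demands.
  have hsum : ∑ e : Fin M → Fin N × Fin N,
      ((2 / N) * (∑ l ∈ Finset.Ico 3 6, ((cycleWitnesses e l).card : ℝ)) +
        ((indepWitnesses e a).card : ℝ)) < ∑ e : Fin M → Fin N × Fin N, (1 : ℝ) := by
    have hone : ∑ e : Fin M → Fin N × Fin N, (1 : ℝ) = T := by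
      simp [hT, Fintype.card_prod]
    rw [hone, Finset.sum_add_distrib, ← Finset.mul_sum]
    have h1 : (2 / (N : ℝ)) * (3 * (2 * k : ℕ) ^ 5 * T) < 1 / 2 * T := by
      rw [← mul_assoc]
      refine mul_lt_mul_of_pos_right ?_ hTpos
      rw [div_mul_eq_mul_div, div_lt_iff₀ hNR]
      have h2 : ((12 * (2 * k) ^ 5 : ℕ) : ℝ) < N := by exact_mod_cast ha.trans_le haN
      push_cast at h2 ⊢
      linarith
    have h3 := mul_le_mul_of_nonneg_left hcyc (by positivity : (0 : ℝ) ≤ 2 / N)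
    linarith
  obtain ⟨e, -, he⟩ := Finset.exists_lt_of_sum_lt hsum
  have hc0 : 0 ≤ (2 / (N : ℝ)) * ∑ l ∈ Finset.Ico 3 6, ((cycleWitnesses e l).card : ℝ) := by
    positivity
  have hi0 : (0 : ℝ) ≤ (indepWitnesses e a).card := by positivity
  refine ⟨M, e, ?_, ?_⟩
  · have h1 : (2 / (N : ℝ)) * ∑ l ∈ Finset.Ico 3 6, ((cycleWitnesses e l).card : ℝ) < 1 := by
      linarith
    rw [div_mul_eq_mul_div, div_lt_one hNR] at h1
    exact_mod_cast h1
  · have h1 : ((indepWitnesses e a).card : ℝ) < 1 := by linarith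
    have h2 : (indepWitnesses e a).card < 1 := by exact_mod_cast h1
    exact Finset.card_eq_zero.1 (by omega)

theorem exists_egirth_six (K : ℕ) (hK : 1 ≤ K) :
    ∃ (m : ℕ) (G : SimpleGraph (Fin m)),
      G.egirth = 6 ∧ (K : ℝ) ≤ fractionalChromaticNumber G := by
  classical
  obtain ⟨a, ha⟩ : ∃ a, a = 12 * (2 * (16 * K ^ 2)) ^ 5 + 2 := ⟨_, rfl⟩
  obtain ⟨N, hN⟩ : ∃ N, N = 2 * K * a := ⟨_, rfl⟩
  obtain ⟨M, e, hcyc, hind⟩ := exists_sparse_pairGraph hN hK (by omega) (by omega)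
  let D : Finset (Fin N) := (Finset.Ico 3 6).biUnion fun l =>
    (cycleWitnesses e l).biUnion fun t => Finset.univ.filter fun u => ∃ h : 0 < l, t.1 ⟨0, h⟩ = u
  have hD : 2 * D.card ≤ N := by
    have h1 : D.card ≤ ∑ l ∈ Finset.Ico 3 6, (cycleWitnesses e l).card := by
      refine Finset.card_biUnion_le.trans (Finset.sum_le_sum fun l _ => ?_)
      refine Finset.card_biUnion_le.trans ?_
      rw [Finset.card_eq_sum_ones]
      refine Finset.sum_le_sum fun t _ => ?_
      rw [Finset.card_le_one]
      intro u hu u' hu'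
      obtain ⟨h, rfl⟩ := (Finset.mem_filter.1 hu).2
      obtain ⟨h', rfl⟩ := (Finset.mem_filter.1 hu').2
      rfl
    omega
  -- One vertex per short cycle is isolated rather than removed; `χ_f` is later bounded through
  -- `Dᶜ`, at least half of the vertices.
  let G₀ : SimpleGraph (Fin N) :=
    { Adj := fun x y => (pairGraph e).Adj x y ∧ x ∉ D ∧ y ∉ D
      symm := ⟨fun _ _ h => ⟨h.1.symm, h.2.2, h.2.1⟩⟩
      loopless := ⟨fun _ h => h.1.ne rfl⟩ }
  have hG₀ : ∀ l, 3 ≤ l → l < 6 → ∀ x : Fin l → Fin N, ¬ IsCycleMap G₀ x := by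
    intro l h3 h6 x hx
    have hx' : IsCycleMap (pairGraph e) x := ⟨hx.1, fun j => (hx.2 j).1⟩
    obtain ⟨i, o, hio⟩ := hx'.exists_mem_cycleWitnesses h3
    refine (hx.2 ⟨0, by omega⟩).2.1 ?_
    simp only [D, Finset.mem_biUnion, Finset.mem_Ico, Finset.mem_filter, Finset.mem_univ, true_and]
    exact ⟨l, ⟨h3, h6⟩, _, hio, by omega, rfl⟩
  let f : Fin (Fintype.card (Fin N ⊕ Fin 6)) ≃ Fin N ⊕ Fin 6 := (Fintype.equivFin _).symm
  refine ⟨_, (G₀ ⊕g SimpleGraph.cycleGraph 6).comap f, ?_, ?_⟩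
  · rw [(SimpleGraph.Iso.comap f (G₀ ⊕g SimpleGraph.cycleGraph 6)).egirth_eq]
    exact egirth_sum_cycleGraph_six hG₀
  · let g : Fin N ↪ Fin (Fintype.card (Fin N ⊕ Fin 6)) :=
      ⟨fun u => f.symm (Sum.inl u), f.symm.injective.comp Sum.inl_injective⟩
    have hbound := card_le_mul_fractionalChromaticNumber
      (G := (G₀ ⊕g SimpleGraph.cycleGraph 6).comap f) (Dᶜ.map g) a (by omega) ?_
    · refine le_trans ?_ hbound
      rw [Finset.card_map, le_div_iff₀ (by rw [ha]; positivity)]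
      have h1 : D.card + Dᶜ.card = N := by rw [Finset.card_add_card_compl, Fintype.card_fin]
      have h2 : K * a ≤ Dᶜ.card := by
        have : 2 * (K * a) = N := by rw [hN]; ring
        omega
      exact_mod_cast h2
    · intro I hI hIU
      by_contra hlt
      push Not at hlt
      obtain ⟨J, hJD, rfl⟩ := Finset.subset_map_iff.1 hIU
      rw [Finset.card_map] at hlt
      obtain ⟨S, hSJ, hS⟩ := Finset.exists_subset_card_eq hlt.le
      have : S ∈ indepWitnesses e a := by
        rw [indepWitnesses, Finset.mem_filter]
        refine ⟨Finset.mem_univ _, hS, ?_⟩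
        intro u hu v hv huv hadj
        refine hI (x := g u) (Finset.mem_coe.2 (Finset.mem_map_of_mem g (hSJ hu))) (y := g v)
          (Finset.mem_coe.2 (Finset.mem_map_of_mem g (hSJ hv))) (g.injective.ne huv) ?_
        simp only [g, SimpleGraph.comap_adj, Function.Embedding.coeFn_mk, Equiv.apply_symm_apply,
          SimpleGraph.sum_adj_inl]
        exact ⟨hadj, Finset.mem_compl.1 (hJD (hSJ hu)), Finset.mem_compl.1 (hJD (hSJ hv))⟩
      rw [hind] at this
      simp at this

/-! ### The asymptotic bound -/

theorem poljakRodl_mono : Monotone poljakRodl := by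
  intro n n' h
  obtain ⟨V, W, hV, hW, G, H, hG, hH, hGH⟩ := Nat.sInf_mem (poljakRodlValues_nonempty n')
  have h' : (n : ℕ∞) ≤ n' := Nat.cast_le.2 h
  exact Nat.sInf_le ⟨V, W, hV, hW, G, H, h'.trans hG, h'.trans hH, hGH⟩

theorem poljakRodl_zero : poljakRodl 0 = 0 := by
  refine Nat.le_zero.1 (Nat.sInf_le ?_)
  refine ⟨Empty, Empty, inferInstance, inferInstance, ⊥, ⊥, by simp, by simp, ?_⟩
  rw [SimpleGraph.chromaticNumber_eq_zero_of_isEmpty]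
  rfl

/-- Take `d = D + 1` and `c ≈ 4q ≈ n/(2D)`: then `2dc - 2c = 2Dc ≈ n`, and `dc ≈ n/2 + n/(2D)`. The
graph is fixed by `D`, so `q` is large enough eventually. -/
theorem exists_poljakRodl_le {D : ℕ} (hD : 1 ≤ D) :
    ∃ C : ℝ, ∀ᶠ n : ℕ in atTop, (poljakRodl n : ℝ) ≤ n / 2 + n / (2 * D) + C := by
  obtain ⟨m, G, hG, hf⟩ := exists_egirth_six (9 * (D + 1)) (by omega)
  refine ⟨6 * (D + 1), ?_⟩
  filter_upwards [eventually_ge_atTop (8 * D * m ^ 2)] with n hn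
  have hD' : (0 : ℝ) < D := by exact_mod_cast hD
  obtain ⟨q, hq⟩ : ∃ q, q = n / (8 * D) := ⟨_, rfl⟩
  have hqm : m ^ 2 ≤ q := by
    rw [hq, Nat.le_div_iff_mul_le (by omega)]
    linarith
  -- Using `q + 1` compensates the floor in `q`, so the argument of `f` reaches at least `n`.
  have hbound := (blowup_bounds (d := D + 1) (q := q + 1) (c := 4 * (q + 1) + 2) (by omega)
    hG.ge (by push_cast at hf ⊢; linarith) (by rw [Fintype.card_fin]; omega) rfl).2.2.2
  have hlt : n < 8 * D * (q + 1) := by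
    rw [hq]; exact Nat.lt_mul_div_succ n (by omega)
  have harg : n ≤ 2 * (D + 1) * (4 * (q + 1) + 2) - 2 * (4 * (q + 1) + 2) + 2 := by
    have : 2 * (D + 1) * (4 * (q + 1) + 2) =
        8 * D * (q + 1) + 4 * D + 2 * (4 * (q + 1) + 2) := by ring
    omega
  have h1 : (poljakRodl n : ℝ) ≤ ((D + 1) * (4 * (q + 1) + 2) : ℕ) := by
    exact_mod_cast (poljakRodl_mono harg).trans hbound
  have h2 : (q : ℝ) ≤ n / (8 * D) := by
    rw [hq]
    refine Nat.cast_div_le.trans (le_of_eq ?_)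
    push_cast; rfl
  calc (poljakRodl n : ℝ) ≤ 4 * (D + 1) * q + 6 * (D + 1) := by
        refine h1.trans (le_of_eq ?_); push_cast; ring
    _ ≤ 4 * (D + 1) * (n / (8 * D)) + 6 * (D + 1) := by gcongr
    _ = n / 2 + n / (2 * D) + 6 * (D + 1) := by field_simp; ring

theorem exists_error_term : ∃ r : ℕ → ℝ, Tendsto r atTop (𝓝 0) ∧
    ∀ n : ℕ, (poljakRodl n : ℝ) ≤ (1 / 2 + r n) * (n : ℝ) := by
  -- The positive part of the excess ratio makes the inequality automatic for `n > 0`; `n = 0` needs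
  -- `f(0) = 0`.
  refine ⟨fun n => max ((poljakRodl n : ℝ) / n - 1 / 2) 0, ?_, fun n => ?_⟩
  · rw [Metric.tendsto_nhds]
    intro ε hε
    obtain ⟨D, hD⟩ := exists_nat_gt (1 / ε)
    have hD0 : (0 : ℝ) < D := (by positivity : 0 < 1 / ε).trans hD
    obtain ⟨C, hC⟩ := exists_poljakRodl_le (D := D) (by exact_mod_cast hD0)
    obtain ⟨N, hN⟩ := exists_nat_gt (2 * C / ε)
    filter_upwards [hC, eventually_ge_atTop N, eventually_ge_atTop 1] with n h1 h2 h3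
    have hn : (0 : ℝ) < n := by exact_mod_cast h3
    have h4 : 2 * C / ε < n := hN.trans_le (by exact_mod_cast h2)
    rw [div_lt_iff₀ hε] at h4
    rw [Real.dist_eq, sub_zero, abs_of_nonneg (le_max_right _ _), max_lt_iff]
    refine ⟨?_, hε⟩
    rw [sub_lt_iff_lt_add, div_lt_iff₀ hn]
    have h5 : (n : ℝ) / (2 * D) ≤ n * ε / 2 := by
      rw [div_le_iff₀ (by positivity)]
      rw [div_lt_iff₀ hε] at hD
      nlinarith
    linarith
  · rcases Nat.eq_zero_or_pos n with rfl | hn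
    · simp [poljakRodl_zero]
    · have hn' : (0 : ℝ) < n := by exact_mod_cast hn
      rw [← div_le_iff₀ hn']
      have := le_max_left ((poljakRodl n : ℝ) / n - 1 / 2) 0
      linarith

theorem theorem4p1 :
    -- the chromatic numbers of `G[K_q]` and of its exponential graph, and the bound on `f`
    (∀ (d : ℕ), 1 ≤ d →
      ∀ (V : Type*) [Fintype V] (G : SimpleGraph V),
        6 ≤ G.egirth →
        (8.1 : ℝ) * (d : ℝ) ≤ fractionalChromaticNumber G →
        ∀ p q c : ℕ, p = Fintype.card V → 2 ^ (p - 1) * p ^ 2 ≤ q → c = 4 * q + 2 →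
          ((2 * d * c - 2 * c + 2 : ℕ) : ℕ∞) ≤ (cliqueBlowup G q).chromaticNumber ∧
          -- the exponential graph has no loops
          (∀ φ : V × Fin q → Fin (d * c), ¬ ExpAdj (cliqueBlowup G q) (d * c) φ φ) ∧
          ((2 * d * c - 2 * c + 2 : ℕ) : ℕ∞) ≤
            (expGraph (cliqueBlowup G q) (d * c)).chromaticNumber ∧
          poljakRodl (2 * d * c - 2 * c + 2) ≤ d * c) ∧
    -- such graphs exist for every `d`
    (∀ (d : ℕ), 1 ≤ d →
      ∃ (m : ℕ) (G : SimpleGraph (Fin m)),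
        G.egirth = 6 ∧ (8.1 : ℝ) * (d : ℝ) ≤ fractionalChromaticNumber G) ∧
    -- `f(n) ≤ (1/2 + o(1)) n`
    (∃ r : ℕ → ℝ, Tendsto r atTop (𝓝 0) ∧
      ∀ n : ℕ, (poljakRodl n : ℝ) ≤ (1 / 2 + r n) * (n : ℝ)) := by
  refine ⟨fun d hd V _ G hg hf p q c hp hq hc => ?_, fun d hd => ?_, exists_error_term⟩
  · refine blowup_bounds hd hg hf ?_ hc
    rw [← hp]
    exact (Nat.le_mul_of_pos_left _ (by positivity)).trans hq
  · obtain ⟨m, G, hG, hf⟩ := exists_egirth_six (9 * d) (by omega)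
    refine ⟨m, G, hG, le_trans ?_ hf⟩
    push_cast
    have : (0 : ℝ) ≤ d := Nat.cast_nonneg d
    linarith
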